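/- **Conventions.** For a metric space $(X,d)$ let $\mathcal P(X)$ be the set of Borel probability measures on $X$ that are concentrated on a separable subset. For $\mu,\nu\in\mathcal P(X)$ put $$d_W(\mu,\nu)=\inf_K\int_{X\times X}d(x,y)\,\mathrm dK(x,y)\in[0,\infty],$$ where $K$ ranges over all $K\in\mathcal P(X\times X)$ with marginals $\mu$ and $\nu$, and let $\mathcal P_1(X)$ be the set of $\mu\in\mathcal P(X)$ with $d_W(\delta_x,\mu)<\infty$ for some $x\in X$. A *contracting barycenter map* on $X$ is a map $b:\mathcal P_1(X)\to X$ with $b(\delta_x)=x$ for all $x\in X$ and $d(b(\mu),b(\nu))\le d_W(\mu,\nu)$ for all $\mu,\nu\in\mathcal P_1(X)$. An *area functional* $\mathcal A$ assigns to every Lipschitz map $f:E\to X$ from a Borel set $E\subseteq\mathbb R^2$ to a metric space $X$ a number $\mathcal A(f)\in[0,\infty]$ such that, for all such $f$: 1. if $X$ is a smooth Riemannian manifold (with its Riemannian distance), then $\mathcal A(f)=\int_X\operatorname{card}(f^{-1}(y))\,\mathrm d\mathcal H^2(y)$, where the Hausdorff measure $\mathcal H^2$ is normalized to be Lebesgue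 measure on $\mathbb R^2$; 2. $\mathcal A(g\circ f)\le L^2\mathcal A(f)$ for every $L$-Lipschitz map $g:X\to Y$ into a metric space $Y$ (with $0\cdot\infty=0$); 3. $\mathcal A(f\circ\varphi)=\mathcal A(f)$ for every bi-Lipschitz bijection $\varphi:E'\to E$ from a Borel set $E'\subseteq\mathbb R^2$; 4. $\mathcal A(f)=\sum_{i=1}^\infty\mathcal A(f|_{E_i})$ whenever $E$ is the disjoint union of Borel sets $E_1,E_2,\dots$. Let $D^2\subset\mathbb R^2$ be the closed unit disc and $S^1=\partial D^2$. For a Lipschitz curve $\eta:S^1\to X$ let $L_\eta$ be its length and let $\mathrm{Fill}_{\mathcal A}(\eta)=\inf_f\mathcal A(f)$, where $f$ ranges over all Lipschitz maps $f:D^2\to X$ with $f|_{S^1}=\eta$ (and $\inf\emptyset=\infty$). **Theorem 1.2.** Let $\mathcal A$ be an area functional and $X$ a metric space. If $X$ admits a contracting barycenter map, then $X$ satisfies a $\frac1{2\pi}$-quadratic isoperimetric inequality with respect to $\mathcal A$, that is, $$\mathrm{Fill}_{\mathcal A}(\eta)\le\frac1{2\pi}\,L_\eta^2\qquad\text{for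 every Lipschitz curve }\eta:S^1\to X.$$ -/

import Mathlib

open MeasureTheory Set
open scoped ENNReal NNReal

namespace QuadIsop

universe u

noncomputable section

/-! ### Wasserstein `1`-space and contracting barycenter maps -/

section Wasserstein

/-- A measure is separably supported if it is concentrated on a separable set. -/
def SeparablySupported {Y : Type u} [TopologicalSpace Y] [MeasurableSpace Y]
    (μ : Measure Y) : Prop :=
  ∃ S : Set Y, TopologicalSpace.IsSeparable S ∧ μ Sᶜ = 0

/-- Membership in `𝒫(Y)`: separably supported probability measures. It is used with the Borel
σ-algebra of `Y`. -/
structure IsSepProb {Y : Type u} [TopologicalSpace Y] [MeasurableSpace Y]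
    (μ : Measure Y) : Prop where
  isProbabilityMeasure : IsProbabilityMeasure μ
  separablySupported : SeparablySupported μ

variable {X : Type u} [MetricSpace X] [MeasurableSpace X]

/-- `K` is a coupling of `μ` and `ν`: an element of `𝒫(X × X)` with marginals `μ` and `ν`.
Here `X × X` carries its Borel σ-algebra, which for non-separable `X` may be larger than the
product σ-algebra that is the default in Mathlib. -/
structure IsCoupling (μ ν : Measure X) (K : @Measure (X × X) (borel (X × X))) : Prop where
  isSepProb : @IsSepProb (X × X) _ (borel (X × X)) K
  map_fst : @Measure.map (X × X) X (borel (X × X)) _ Prod.fst K = μ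
  map_snd : @Measure.map (X × X) X (borel (X × X)) _ Prod.snd K = ν

/-- The Wasserstein `1`-distance: the infimum of `∫ d(x, y) dK(x, y)` over all couplings `K`. -/
def wassersteinEDist (μ ν : Measure X) : ℝ≥0∞ :=
  ⨅ (K : @Measure (X × X) (borel (X × X))) (_ : IsCoupling μ ν K),
    @lintegral (X × X) (borel (X × X)) K fun p => edist p.1 p.2

variable (X) in
/-- Wasserstein `1`-space `𝒫₁(X)`: the separably supported Borel probability measures at finite
Wasserstein `1`-distance from some Dirac measure. -/
def WassersteinOne : Type u :=
  {μ : Measure X // IsSepProb μ ∧ ∃ x : X, wassersteinEDist (Measure.dirac x) μ < ∞}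

theorem isSepProb_dirac {Y : Type u} [TopologicalSpace Y] [T1Space Y] {m : MeasurableSpace Y}
    [BorelSpace Y] (y : Y) : IsSepProb (Measure.dirac y) := by
  refine ⟨inferInstance, {y}, (Set.countable_singleton y).isSeparable, ?_⟩
  rw [Measure.dirac_apply' _ (measurableSet_singleton y).compl]
  simp

theorem isCoupling_dirac [BorelSpace X] (x : X) :
    IsCoupling (Measure.dirac x) (Measure.dirac x)
      (@Measure.dirac (X × X) (borel (X × X)) (x, x)) := by
  let m : MeasurableSpace (X × X) := borel (X × X)
  have : @BorelSpace (X × X) _ m := @BorelSpace.mk _ _ m rfl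
  have h1 : @Measurable _ _ m _ (Prod.fst : X × X → X) := continuous_fst.borel_measurable.mono
    le_rfl (BorelSpace.measurable_eq (α := X)).le
  have h2 : @Measurable _ _ m _ (Prod.snd : X × X → X) := continuous_snd.borel_measurable.mono
    le_rfl (BorelSpace.measurable_eq (α := X)).le
  exact ⟨isSepProb_dirac (m := m) (x, x), @Measure.map_dirac' _ _ m _ _ h1 _,
    @Measure.map_dirac' _ _ m _ _ h2 _⟩

/-- The Dirac map `δ : X → 𝒫₁(X)`. -/
def WassersteinOne.dirac [BorelSpace X] (x : X) : WassersteinOne X :=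
  ⟨Measure.dirac x, isSepProb_dirac x, x, by
    let m : MeasurableSpace (X × X) := borel (X × X)
    have : @BorelSpace (X × X) _ m := @BorelSpace.mk _ _ m rfl
    refine lt_of_le_of_lt (iInf₂_le _ (isCoupling_dirac x)) ?_
    have hm : @Measurable _ _ m _ (fun p : X × X => edist p.1 p.2) :=
      (continuous_fst.edist continuous_snd).measurable
    rw [@lintegral_dirac' _ m _ _ hm]
    simp⟩

/-- A contracting barycenter map: a `1`-Lipschitz retraction `b : 𝒫₁(X) → X` for the Dirac map. -/
structure IsContractingBarycenterMap [BorelSpace X] (b : WassersteinOne X → X) : Prop where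
  map_dirac : ∀ x : X, b (WassersteinOne.dirac x) = x
  contracting : ∀ μ ν : WassersteinOne X, edist (b μ) (b ν) ≤ wassersteinEDist μ.1 ν.1

end Wasserstein

/-! ### Area functionals -/

section Area

/-- The Euclidean plane. -/
abbrev Plane : Type := EuclideanSpace ℝ (Fin 2)

/-- The map `f` is Lipschitz for some constant. -/
def IsLipschitz {X Y : Type*} [MetricSpace X] [MetricSpace Y] (f : X → Y) : Prop :=
  ∃ K : ℝ≥0, LipschitzWith K f

/-- The Busemann area `∫ card (f⁻¹(y)) dℋ²(y)`: the `2`-dimensional Hausdorff measure of the image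
counted with multiplicity. The measure `μHE[2]` is the Hausdorff measure normalized so that it is
Lebesgue measure on the Euclidean plane. -/
def busemannArea {X : Type u} [MetricSpace X] [MeasurableSpace X] [BorelSpace X]
    {E : Set Plane} (f : E → X) : ℝ≥0∞ :=
  ∫⁻ y, ((f ⁻¹' {y}).encard : ℝ≥0∞) ∂(μHE[2] : Measure X)

open scoped Manifold ContDiff Bundle in
/-- The metric space `X` is (isometric to) a smooth finite-dimensional Riemannian manifold without
boundary with its Riemannian distance. Since the distance is finite the manifold is connected, so
has at most the cardinality of the continuum; hence nothing is lost by taking `M : Type`. -/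
def IsRiemannianSpace (X : Type u) [MetricSpace X] : Prop :=
  ∃ (n : ℕ) (M : Type) (_ : MetricSpace M) (_ : ChartedSpace (EuclideanSpace ℝ (Fin n)) M)
    (_ : IsManifold 𝓘(ℝ, EuclideanSpace ℝ (Fin n)) ∞ M)
    (_ : Bundle.RiemannianBundle
      (fun x : M => TangentSpace 𝓘(ℝ, EuclideanSpace ℝ (Fin n)) x)),
    IsContMDiffRiemannianBundle 𝓘(ℝ, EuclideanSpace ℝ (Fin n)) ∞ (EuclideanSpace ℝ (Fin n))
      (fun x : M => TangentSpace 𝓘(ℝ, EuclideanSpace ℝ (Fin n)) x) ∧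
    IsRiemannianManifold 𝓘(ℝ, EuclideanSpace ℝ (Fin n)) M ∧
    Nonempty (X ≃ᵢ M)

/-- An area functional assigns a number in `[0, ∞]` to every Lipschitz map `f : E → X` from a Borel
set `E` of the plane to a metric space, subject to normalization, monotonicity, coordinate
invariance and `σ`-additivity. The values of `area` on other maps carry no meaning and are not
restricted. -/
structure AreaFunctional where
  area : ∀ {X : Type u} [MetricSpace X] {E : Set Plane}, (E → X) → ℝ≥0∞
  normalization : ∀ {X : Type u} [MetricSpace X] [MeasurableSpace X] [BorelSpace X]
    {E : Set Plane} (f : E → X), MeasurableSet E → IsLipschitz f → IsRiemannianSpace X →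
      area f = busemannArea f
  monotonicity : ∀ {X Y : Type u} [MetricSpace X] [MetricSpace Y] {E : Set Plane}
    (f : E → X) (g : X → Y) (L : ℝ≥0), MeasurableSet E → IsLipschitz f → LipschitzWith L g →
      area (g ∘ f) ≤ (L : ℝ≥0∞) ^ 2 * area f
  coordinate_invariance : ∀ {X : Type u} [MetricSpace X] {E E' : Set Plane}
    (f : E → X) (φ : E' ≃ E), MeasurableSet E → MeasurableSet E' → IsLipschitz f →
      IsLipschitz φ → IsLipschitz φ.symm → area (f ∘ φ) = area f
  sigma_additivity : ∀ {X : Type u} [MetricSpace X] {E : Set Plane} (f : E → X)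
    (S : ℕ → Set Plane) (hSE : ∀ i, S i ⊆ E), MeasurableSet E → (∀ i, MeasurableSet (S i)) →
      E ⊆ ⋃ i, S i → Pairwise (Function.onFun Disjoint S) → IsLipschitz f →
      area f = ∑' i, area (f ∘ Set.inclusion (hSE i))

end Area

/-! ### Fillings and quadratic isoperimetric inequalities -/

section Isoperimetric

/-- The closed unit disc `D²`. -/
abbrev disc : Set Plane := Metric.closedBall (0 : Plane) 1

/-- The unit circle `S¹ = ∂D²`. -/
abbrev circle : Set Plane := Metric.sphere (0 : Plane) 1

/-- The standard parametrization `t ↦ (cos t, sin t)` of the unit circle. -/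
def circleParam (t : ℝ) : circle :=
  ⟨!₂[Real.cos t, Real.sin t], by
    simp [EuclideanSpace.norm_eq, Fin.sum_univ_two]⟩

variable {X : Type u} [MetricSpace X]

/-- The length of a closed curve `η : S¹ → X`. -/
def curveLength (η : circle → X) : ℝ≥0∞ :=
  eVariationOn (fun t : ℝ => η (circleParam t)) (Set.Icc 0 (2 * Real.pi))

/-- A filling of `η` is a Lipschitz map on the closed disc that restricts to `η` on the circle. -/
structure IsFilling (η : circle → X) (f : disc → X) : Prop where
  isLipschitz : IsLipschitz f
  restrict_eq : ∀ p : circle, f (Set.inclusion Metric.sphere_subset_closedBall p) = η p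

/-- The filling area of `η`; it is `∞` if there is no filling. -/
def fillingArea (A : AreaFunctional.{u}) (η : circle → X) : ℝ≥0∞ :=
  ⨅ (f : disc → X) (_ : IsFilling η f), A.area f

variable (X) in
/-- The `C`-quadratic isoperimetric inequality with respect to `A`. -/
def QuadraticIsoperimetricInequality (A : AreaFunctional.{u}) (C : ℝ) : Prop :=
  ∀ η : circle → X, IsLipschitz η →
    fillingArea A η ≤ ENNReal.ofReal C * curveLength η ^ 2

end Isoperimetric

end

end QuadIsop

namespace QuadIsop

universe u

noncomputable section

open ProbabilityTheory Filter Topology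

/-! ### The quantile coupling on the line -/

/-! Let `γ` be the curve parametrized with constant speed over an angle of period 2π, so that its
Lipschitz constant is K = L/2π. If `γ` extends to the unit hemisphere with the same constant K, the
extension has area at most K² · 2π = L²/2π, because the hemisphere has area 2π. The barycenter map
provides this extension once each point p of the open hemisphere is assigned a probability measure
μ_p on the equator such that the transport distance between μ_p and μ_q is at most the spherical
distance of p and q, and the mean distance of μ_p to a boundary point is at most the spherical
distance to that point. The extension then sends p to the barycenter of the push-forward of μ_p
under `γ`.

Let d be the spherical distance from p, restricted to the equator. As the distance on the circle has
second derivative twice the Dirac mass at the base point minus that at its antipode, the mean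
distance of a density ρ to x should equal d(x) when ρ(x) - ρ(x + π) = d''(x)/2. Accordingly ρ is
half the positive part of d'', plus the uniform density that makes the total mass 1 (`density`). In
gnomonic coordinates great circles are lines, and after a rotation two given points lie on a line y
= const, which ends at angle 0. Moving towards that end increases the mass of every arc starting at
0 (`mass_mono`) and keeps the masses of the two half circles fixed (`mass_pi`). Hence all transport
goes towards 0, and its cost is the difference of the mean distances to 0. These means are spherical
distances (`integral_mul_density_add`), and their difference is the distance of the two points,
since they lie on a common great circle with angle 0.

The area of the extension is estimated on thin half annuli. There the map factors through a flat
rectangle by a K-Lipschitz map of the plane (`dist_hemisphereMap_le`), so monotonicity and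
normalization bound the area; the sum is a Riemann sum that tends to 2πK². A collar that stays in
the image of `γ` adjusts the parametrization and has area zero. -/

/-- The quantile function of a measure on the line, extended by `0` outside `(0, 1)`. -/
def quantile (ν : Measure ℝ) : ℝ → ℝ :=
  (Ioo (0 : ℝ) 1).indicator fun u => sInf {x | u ≤ cdf ν x}

/-- The infimum is attained, by right continuity of the distribution function. This Galois
connection is the only property of quantiles used below. -/
theorem quantile_le_iff (ν : Measure ℝ) {u x : ℝ} (hu : u ∈ Ioo (0 : ℝ) 1) :
    quantile ν u ≤ x ↔ u ≤ cdf ν x := by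
  rw [quantile, indicator_of_mem hu]
  have hne : {x | u ≤ cdf ν x}.Nonempty :=
    (((tendsto_cdf_atTop ν).eventually (lt_mem_nhds hu.2)).exists).imp fun _ h => h.le
  have hbdd : BddBelow {x | u ≤ cdf ν x} := by
    obtain ⟨z, hz⟩ := ((tendsto_cdf_atBot ν).eventually (gt_mem_nhds hu.1)).exists
    refine ⟨z, fun w hw => ?_⟩
    by_contra! h
    exact absurd (hw.trans (monotone_cdf ν h.le)) (not_le.2 hz)
  refine ⟨fun h => ?_, fun h => csInf_le hbdd h⟩
  refine le_trans ?_ (monotone_cdf ν h)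
  set a := sInf {x | u ≤ cdf ν x}
  have hr : Tendsto (cdf ν) (𝓝[>] a) (𝓝 (cdf ν a)) :=
    ((cdf ν).right_continuous a).mono_left (nhdsWithin_mono _ Ioi_subset_Ici_self)
  refine ge_of_tendsto hr ?_
  filter_upwards [self_mem_nhdsWithin] with y hy
  obtain ⟨w, hw, hwy⟩ := (csInf_lt_iff hbdd hne).1 hy
  exact le_trans hw (monotone_cdf ν hwy.le)

theorem measurable_quantile (ν : Measure ℝ) : Measurable (quantile ν) := by
  refine measurable_of_Iic fun x => ?_
  have : quantile ν ⁻¹' Iic x =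
      (Ioo 0 1 ∩ Iic (cdf ν x)) ∪ ((Ioo 0 1)ᶜ ∩ {_u | 0 ≤ x}) := by
    ext u
    by_cases hu : u ∈ Ioo (0 : ℝ) 1
    · have := quantile_le_iff ν (x := x) hu
      simp only [mem_preimage, mem_Iic, mem_union, mem_inter_iff, mem_compl_iff, hu, this]
      simp
    · simp [quantile, hu]
  rw [this]
  exact (measurableSet_Ioo.inter measurableSet_Iic).union
    (measurableSet_Ioo.compl.inter (MeasurableSet.const _))

instance isProbabilityMeasure_restrict_Ioo :
    IsProbabilityMeasure (volume.restrict (Ioo (0 : ℝ) 1)) := ⟨by simp⟩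

theorem map_quantile (ν : Measure ℝ) [IsProbabilityMeasure ν] :
    (volume.restrict (Ioo (0 : ℝ) 1)).map (quantile ν) = ν := by
  have := Measure.isProbabilityMeasure_map (μ := volume.restrict (Ioo (0 : ℝ) 1))
    (measurable_quantile ν).aemeasurable
  refine Measure.ext_of_Iic _ _ fun x => ?_
  rw [Measure.map_apply (measurable_quantile ν) measurableSet_Iic, ← ofReal_cdf,
    Measure.restrict_apply (measurable_quantile ν measurableSet_Iic)]
  have h : quantile ν ⁻¹' Iic x ∩ Ioo 0 1 = Ioo 0 1 ∩ Iic (cdf ν x) := by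
    ext u
    by_cases hu : u ∈ Ioo (0 : ℝ) 1
    · simp only [mem_inter_iff, hu, mem_preimage, mem_Iic, quantile_le_iff ν hu]; simp
    · simp only [mem_inter_iff, hu]; simp
  rw [h]
  have h1 := cdf_le_one ν x
  rcases h1.lt_or_eq with h1 | h1
  · have : Ioo 0 1 ∩ Iic (cdf ν x) = Ioc 0 (cdf ν x) := by
      ext u; simp only [mem_inter_iff, mem_Ioo, mem_Iic, mem_Ioc]
      exact ⟨fun h => ⟨h.1.1, h.2⟩, fun h => ⟨⟨h.1, h.2.trans_lt h1⟩, h.2⟩⟩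
    rw [this]; simp
  · rw [h1, inter_eq_left.2 fun u hu => hu.2.le]; simp

/-- Both sides measure the region `A` between the graphs of the two distribution functions, sliced
horizontally on the left and vertically on the right; Tonelli's theorem exchanges the slices. -/
theorem lintegral_edist_quantile_le (ν₁ ν₂ : Measure ℝ) :
    ∫⁻ u in Ioo (0 : ℝ) 1, edist (quantile ν₁ u) (quantile ν₂ u) ≤
      ∫⁻ x, ENNReal.ofReal |cdf ν₁ x - cdf ν₂ x| := by
  let A : Set (ℝ × ℝ) := {p | p.1 ≤ cdf ν₁ p.2 ∧ cdf ν₂ p.2 < p.1} ∪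
    {p | p.1 ≤ cdf ν₂ p.2 ∧ cdf ν₁ p.2 < p.1}
  have m1 : Measurable fun p : ℝ × ℝ => cdf ν₁ p.2 :=
    (monotone_cdf ν₁).measurable.comp measurable_snd
  have m2 : Measurable fun p : ℝ × ℝ => cdf ν₂ p.2 :=
    (monotone_cdf ν₂).measurable.comp measurable_snd
  have hA : MeasurableSet A :=
    ((measurableSet_le measurable_fst m1).inter (measurableSet_lt m2 measurable_fst)).union
      ((measurableSet_le measurable_fst m2).inter (measurableSet_lt m1 measurable_fst))
  have h1 : ∀ u ∈ Ioo (0 : ℝ) 1, edist (quantile ν₁ u) (quantile ν₂ u) =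
      ∫⁻ x, A.indicator 1 (u, x) := by
    intro u hu
    have : ∀ x, A.indicator (1 : ℝ × ℝ → ℝ≥0∞) (u, x) =
        (Ico (min (quantile ν₁ u) (quantile ν₂ u)) (max (quantile ν₁ u) (quantile ν₂ u))).indicator
          1 x := by
      intro x
      have : (u, x) ∈ A ↔ x ∈ Ico (min (quantile ν₁ u) (quantile ν₂ u))
          (max (quantile ν₁ u) (quantile ν₂ u)) := by
        simp only [A, mem_union, mem_ofPred_eq, ← quantile_le_iff ν₁ hu, ← quantile_le_iff ν₂ hu,
          ← not_le, mem_Ico, min_le_iff, max_le_iff]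
        tauto
      by_cases h : (u, x) ∈ A
      · rw [indicator_of_mem h, indicator_of_mem (this.1 h)]; rfl
      · rw [indicator_of_notMem h, indicator_of_notMem (fun h' => h (this.2 h'))]
    simp_rw [this]
    rw [lintegral_indicator_one measurableSet_Ico, Real.volume_Ico, max_sub_min_eq_abs,
      edist_dist, Real.dist_eq, abs_sub_comm]
  rw [setLIntegral_congr_fun measurableSet_Ioo h1]
  rw [lintegral_lintegral_swap (f := fun u x => A.indicator 1 (u, x))
    (Measurable.aemeasurable (Measurable.indicator measurable_one hA))]
  refine lintegral_mono fun x => ?_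
  have h2 : ∀ u : ℝ, A.indicator (1 : ℝ × ℝ → ℝ≥0∞) (u, x) =
      (Ioc (min (cdf ν₁ x) (cdf ν₂ x)) (max (cdf ν₁ x) (cdf ν₂ x))).indicator 1 u := by
    intro u
    have : (u, x) ∈ A ↔ u ∈ Ioc (min (cdf ν₁ x) (cdf ν₂ x)) (max (cdf ν₁ x) (cdf ν₂ x)) := by
      simp only [A, mem_union, mem_ofPred_eq, mem_Ioc, min_lt_iff, le_max_iff]
      constructor
      · tauto
      · rintro ⟨h | h, h' | h'⟩
        · exact absurd h (not_lt.2 h')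
        · exact Or.inr ⟨h', h⟩
        · exact Or.inl ⟨h', h⟩
        · exact absurd h (not_lt.2 h')
    by_cases h : (u, x) ∈ A
    · rw [indicator_of_mem h, indicator_of_mem (this.1 h)]; rfl
    · rw [indicator_of_notMem h, indicator_of_notMem (fun h' => h (this.2 h'))]
  simp_rw [h2]
  refine (setLIntegral_le_lintegral _ _).trans ?_
  rw [lintegral_indicator_one measurableSet_Ioc, Real.volume_Ioc, max_sub_min_eq_abs,
    abs_sub_comm]

variable {X : Type u} [MetricSpace X] [MeasurableSpace X] [BorelSpace X]

/-- On the image of a Lipschitz curve, the Wasserstein distance is bounded by the integral of the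
difference of the distribution functions. -/
theorem wassersteinEDist_map_le {γ : ℝ → X} {K : ℝ≥0} (hγ : LipschitzWith K γ)
    (ν₁ ν₂ : Measure ℝ) [IsProbabilityMeasure ν₁] [IsProbabilityMeasure ν₂] :
    wassersteinEDist (ν₁.map γ) (ν₂.map γ) ≤
      K * ∫⁻ x, ENNReal.ofReal |cdf ν₁ x - cdf ν₂ x| := by
  let m : MeasurableSpace (X × X) := borel (X × X)
  have hm : @BorelSpace (X × X) _ m := @BorelSpace.mk _ _ m rfl
  let P : Measure ℝ := volume.restrict (Ioo (0 : ℝ) 1)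
  have hP : IsProbabilityMeasure P := isProbabilityMeasure_restrict_Ioo
  let q : ℝ → ℝ × ℝ := fun u => (quantile ν₁ u, quantile ν₂ u)
  have hq : Measurable q := (measurable_quantile ν₁).prodMk (measurable_quantile ν₂)
  have hγc := hγ.continuous
  -- Factoring through ℝ × ℝ by a continuous map gives measurability for the full Borel σ-algebra of
  -- X × X, which may exceed the product σ-algebra.
  have hg : Measurable (fun u => (γ (quantile ν₁ u), γ (quantile ν₂ u)) : ℝ → X × X) :=
    (((hγc.comp continuous_fst).prodMk (hγc.comp continuous_snd)).measurable).comp hq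
  have mf : Measurable (Prod.fst : X × X → X) := continuous_fst.measurable
  have ms : Measurable (Prod.snd : X × X → X) := continuous_snd.measurable
  let C : Measure (X × X) := P.map fun u => (γ (quantile ν₁ u), γ (quantile ν₂ u))
  have hsep : TopologicalSpace.IsSeparable
      (range fun p : ℝ × ℝ => (γ p.1, γ p.2)) :=
    TopologicalSpace.isSeparable_range ((hγc.comp continuous_fst).prodMk (hγc.comp continuous_snd))
  have hC : IsCoupling (ν₁.map γ) (ν₂.map γ) C := by
    refine ⟨⟨Measure.isProbabilityMeasure_map hg.aemeasurable, ?_⟩, ?_, ?_⟩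
    -- The closure is still separable and, unlike the range, is known to be Borel.
    · refine ⟨_, hsep.closure, ?_⟩
      rw [Measure.map_apply hg isClosed_closure.measurableSet.compl]
      convert measure_empty (μ := P)
      refine eq_empty_of_forall_notMem fun u hu => hu (subset_closure ⟨q u, rfl⟩)
    · rw [Measure.map_map mf hg]
      conv_rhs => rw [← map_quantile ν₁, Measure.map_map hγc.measurable (measurable_quantile ν₁)]
      rfl
    · rw [Measure.map_map ms hg]
      conv_rhs => rw [← map_quantile ν₂, Measure.map_map hγc.measurable (measurable_quantile ν₂)]
      rfl
  refine (iInf₂_le C hC).trans ?_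
  have hd : Measurable (fun p : X × X => edist p.1 p.2) :=
    (continuous_fst.edist continuous_snd).measurable
  rw [lintegral_map hd hg]
  calc ∫⁻ u in Ioo (0 : ℝ) 1, edist (γ (quantile ν₁ u)) (γ (quantile ν₂ u))
      ≤ ∫⁻ u in Ioo (0 : ℝ) 1, K * edist (quantile ν₁ u) (quantile ν₂ u) :=
        lintegral_mono fun u => hγ _ _
    _ = K * ∫⁻ u in Ioo (0 : ℝ) 1, edist (quantile ν₁ u) (quantile ν₂ u) :=
        lintegral_const_mul' _ _ ENNReal.coe_ne_top
    _ ≤ _ := mul_le_mul_right (lintegral_edist_quantile_le ν₁ ν₂) _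

theorem isSepProb_map {γ : ℝ → X} (hγ : Continuous γ) (ν : Measure ℝ)
    [IsProbabilityMeasure ν] : IsSepProb (ν.map γ) := by
  refine ⟨Measure.isProbabilityMeasure_map hγ.aemeasurable, _,
    (TopologicalSpace.isSeparable_range hγ).closure, ?_⟩
  rw [Measure.map_apply hγ.measurable isClosed_closure.measurableSet.compl]
  convert measure_empty (μ := ν)
  exact eq_empty_of_forall_notMem fun u hu => hu (subset_closure ⟨u, rfl⟩)

/-- The image under a Lipschitz curve of a measure with finite first moment, as an element of
Wasserstein `1`-space. -/
def WassersteinOne.map {γ : ℝ → X} {K : ℝ≥0} (hγ : LipschitzWith K γ) (ν : Measure ℝ)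
    [IsProbabilityMeasure ν]
    (h : ∫⁻ x, ENNReal.ofReal |cdf (Measure.dirac 0) x - cdf ν x| ≠ ∞) : WassersteinOne X :=
  ⟨ν.map γ, isSepProb_map hγ.continuous ν, γ 0, by
    rw [← Measure.map_dirac' hγ.continuous.measurable]
    exact (wassersteinEDist_map_le hγ _ ν).trans_lt
      (ENNReal.mul_lt_top ENNReal.coe_lt_top h.lt_top)⟩

end

end QuadIsop

namespace QuadIsop

noncomputable section

open Real intervalIntegral

/-! ### A family of probability densities on the circle

The open hemisphere is parametrized by gnomonic coordinates `(ξ, y) ∈ ℝ²`. -/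

/-- The odd increasing function `z / √(1 + z²)`. -/
def phi (z : ℝ) : ℝ := z / √(1 + z ^ 2)

/-- The derivative of `phi`. -/
def dphi (z : ℝ) : ℝ := ((1 + z ^ 2) * √(1 + z ^ 2))⁻¹

theorem one_add_sq_pos (z : ℝ) : 0 < 1 + z ^ 2 := by positivity

theorem hasDerivAt_phi (z : ℝ) : HasDerivAt phi (dphi z) z := by
  have h := one_add_sq_pos z
  have h1 : HasDerivAt (fun z : ℝ => √(1 + z ^ 2)) (2 * z / (2 * √(1 + z ^ 2))) z := by
    simpa using (((hasDerivAt_pow 2 z).const_add 1).sqrt h.ne')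
  have hs : 0 < √(1 + z ^ 2) := sqrt_pos.2 h
  have h2 := (hasDerivAt_id z).div h1 hs.ne'
  refine h2.congr_deriv ?_
  have hsq : √(1 + z ^ 2) ^ 2 = 1 + z ^ 2 := sq_sqrt h.le
  rw [dphi]
  simp only [id]
  generalize √(1 + z ^ 2) = w at *
  rw [← hsq]
  field_simp
  linear_combination hsq

theorem dphi_pos (z : ℝ) : 0 < dphi z := by
  have := one_add_sq_pos z
  rw [dphi]; positivity

theorem dphi_neg (z : ℝ) : dphi (-z) = dphi z := by simp [dphi]

theorem phi_neg (z : ℝ) : phi (-z) = -phi z := by simp [phi, neg_div]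

theorem dphi_le_dphi {z w : ℝ} (h : z ^ 2 ≤ w ^ 2) : dphi w ≤ dphi z := by
  rw [dphi, dphi]
  have := one_add_sq_pos z
  have := one_add_sq_pos w
  gcongr

theorem continuous_phi : Continuous phi :=
  continuous_iff_continuousAt.2 fun z => (hasDerivAt_phi z).continuousAt

theorem continuous_dphi : Continuous dphi := by
  unfold dphi
  refine Continuous.inv₀ (by fun_prop) fun z => ?_
  have := one_add_sq_pos z
  positivity

theorem strictMono_phi : StrictMono phi :=
  strictMono_of_deriv_pos fun z => by rw [(hasDerivAt_phi z).deriv]; exact dphi_pos z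

theorem phi_lt_one (z : ℝ) : phi z < 1 := by
  rw [phi, div_lt_one (sqrt_pos.2 (one_add_sq_pos z))]
  exact lt_sqrt_of_sq_lt (by linarith)

/-- The density on the circle associated with a point of the hemisphere: the part of the second
derivative of the spherical distance on the facing half circle, completed by a uniform density. -/
def density (ξ y x : ℝ) : ℝ :=
  dphi (ξ * sin x - y * cos x) * max (ξ * cos x + y * sin x) 0 / 2 +
    (1 - phi (√(ξ ^ 2 + y ^ 2))) / (2 * π)

theorem continuous_density (ξ y : ℝ) : Continuous (density ξ y) := by
  unfold density
  have := continuous_dphi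
  fun_prop

theorem density_nonneg (ξ y x : ℝ) : 0 ≤ density ξ y x := by
  have h1 := (dphi_pos (ξ * sin x - y * cos x)).le
  have h2 : 0 ≤ 1 - phi (√(ξ ^ 2 + y ^ 2)) := by linarith [phi_lt_one (√(ξ ^ 2 + y ^ 2))]
  have h3 : 0 ≤ max (ξ * cos x + y * sin x) 0 := le_max_right _ _
  unfold density; positivity

theorem density_neg (ξ y x : ℝ) : density ξ y (-x) = density ξ (-y) x := by
  unfold density
  rw [sin_neg, cos_neg, ← dphi_neg]
  congr 3 <;> ring_nf

theorem density_pi_sub (ξ y x : ℝ) : density ξ y (π - x) = density (-ξ) y x := by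
  unfold density
  rw [sin_pi_sub, cos_pi_sub, ← dphi_neg]
  congr 3 <;> ring_nf

theorem density_periodic (ξ y : ℝ) : Function.Periodic (density ξ y) (2 * π) := fun x => by
  simp [density]

/-- Rotations about the pole act linearly on gnomonic coordinates. This permits a choice of axes in
which two given points share the coordinate y. -/
theorem density_rotate (ξ y a x : ℝ) :
    density ξ y (a + x) =
      density (ξ * cos a + y * sin a) (y * cos a - ξ * sin a) x := by
  unfold density
  rw [sin_add, cos_add]
  congr 1
  · congr 2
    · congr 1; ring
    · congr 1; ring
  · congr 4
    linear_combination (-(ξ ^ 2 + y ^ 2)) * (sin_sq_add_cos_sq a)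

theorem hasDerivAt_phi_comp (ξ y x : ℝ) :
    HasDerivAt (fun x => phi (ξ * sin x - y * cos x))
      (dphi (ξ * sin x - y * cos x) * (ξ * cos x + y * sin x)) x := by
  have : HasDerivAt (fun x => ξ * sin x - y * cos x) (ξ * cos x + y * sin x) x := by
    refine (((hasDerivAt_sin x).const_mul ξ).sub ((hasDerivAt_cos x).const_mul y)).congr_deriv ?_
    ring
  exact (hasDerivAt_phi _).comp x this

theorem continuous_deriv_phi_comp (ξ y : ℝ) :
    Continuous fun x => dphi (ξ * sin x - y * cos x) * (ξ * cos x + y * sin x) := by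
  have := continuous_dphi
  fun_prop

theorem integral_deriv_phi_comp (ξ y a b : ℝ) :
    ∫ x in a..b, dphi (ξ * sin x - y * cos x) * (ξ * cos x + y * sin x) =
      phi (ξ * sin b - y * cos b) - phi (ξ * sin a - y * cos a) :=
  integral_eq_sub_of_hasDerivAt (fun x _ => hasDerivAt_phi_comp ξ y x)
    ((continuous_deriv_phi_comp ξ y).intervalIntegrable _ _)

theorem continuous_abs_deriv_phi_comp (ξ y : ℝ) :
    Continuous fun x => dphi (ξ * sin x - y * cos x) * |ξ * cos x + y * sin x| := by
  have := continuous_dphi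
  fun_prop

theorem periodic_abs_deriv_phi_comp (ξ y : ℝ) :
    Function.Periodic (fun x => dphi (ξ * sin x - y * cos x) * |ξ * cos x + y * sin x|) π := by
  intro x
  simp only [sin_add_pi, cos_add_pi]
  rw [← dphi_neg, ← abs_neg]
  congr 2 <;> ring

theorem integral_abs_deriv_phi_comp (ξ y : ℝ) :
    ∫ x in (0 : ℝ)..π, dphi (ξ * sin x - y * cos x) * |ξ * cos x + y * sin x| =
      2 * phi (√(ξ ^ 2 + y ^ 2)) := by
  let w : ℂ := ⟨ξ, y⟩
  have hw : ‖w‖ = √(ξ ^ 2 + y ^ 2) := by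
    rw [Complex.norm_eq_sqrt_sq_add_sq]
  set ρ := √(ξ ^ 2 + y ^ 2)
  set θ := Complex.arg w
  have hξ : ξ = ρ * cos θ := by rw [← hw]; exact (Complex.norm_mul_cos_arg w).symm
  have hy : y = ρ * sin θ := by rw [← hw]; exact (Complex.norm_mul_sin_arg w).symm
  have hρ : 0 ≤ ρ := sqrt_nonneg _
  have hu : ∀ x, ξ * cos x + y * sin x = ρ * cos (x - θ) := fun x => by
    rw [cos_sub, hξ, hy]; ring
  have hz : ∀ x, ξ * sin x - y * cos x = ρ * sin (x - θ) := fun x => by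
    rw [sin_sub, hξ, hy]; ring
  -- By π-periodicity the interval may be moved to the facing half circle around `θ`, where the
  -- absolute value disappears and `phi` gives a primitive.
  have h := (periodic_abs_deriv_phi_comp ξ y).intervalIntegral_add_eq 0 (θ - π / 2)
  rw [zero_add] at h
  rw [h]
  rw [intervalIntegral.integral_congr (g := fun x => dphi (ξ * sin x - y * cos x) * (ξ * cos x + y * sin x)),
    integral_deriv_phi_comp, hz, hz]
  · rw [show θ - π / 2 + π - θ = π / 2 by ring, show θ - π / 2 - θ = -(π / 2) by ring]
    simp [phi_neg]; ring
  · intro x hx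
    rw [uIcc_of_le (by linarith [pi_pos])] at hx
    simp only
    rw [abs_of_nonneg]
    rw [hu]
    exact mul_nonneg hρ (cos_nonneg_of_mem_Icc ⟨by linarith [hx.1], by linarith [hx.2]⟩)

/-- The positive part is split into an exact derivative and a π-periodic term, both of which can be
integrated over [0, π]. -/
theorem density_eq (ξ y x : ℝ) :
    density ξ y x = dphi (ξ * sin x - y * cos x) * (ξ * cos x + y * sin x) / 4 +
      dphi (ξ * sin x - y * cos x) * |ξ * cos x + y * sin x| / 4 +
      (1 - phi (√(ξ ^ 2 + y ^ 2))) / (2 * π) := by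
  have : ∀ u : ℝ, max u 0 = (u + |u|) / 2 := fun u => by
    rcases le_total 0 u with h | h
    · rw [max_eq_left h, abs_of_nonneg h]; ring
    · rw [max_eq_right h, abs_of_nonpos h]; ring
  rw [density, this]; ring

/-! ### Masses of arcs and their monotonicity along great circles -/

/-- The mass of the arc from `0` to `l`. -/
def mass (ξ y l : ℝ) : ℝ := ∫ x in (0 : ℝ)..l, density ξ y x

/-- The value does not involve ξ: along a line y = const no mass passes between the two half
circles, so the circle can be cut at angle π without raising the transport cost. -/
theorem mass_pi (ξ y : ℝ) : mass ξ y π = (1 + phi y) / 2 := by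
  unfold mass
  simp_rw [density_eq]
  rw [intervalIntegral.integral_add, intervalIntegral.integral_add, intervalIntegral.integral_div, intervalIntegral.integral_div, integral_deriv_phi_comp,
    integral_abs_deriv_phi_comp, intervalIntegral.integral_const]
  · simp only [sin_pi, cos_pi, sin_zero, cos_zero]
    norm_num [phi_neg]
    field_simp
    ring
  · exact ((continuous_deriv_phi_comp ξ y).div_const _).intervalIntegrable _ _
  · exact ((continuous_abs_deriv_phi_comp ξ y).div_const _).intervalIntegrable _ _
  · exact (((continuous_deriv_phi_comp ξ y).div_const _).add
      ((continuous_abs_deriv_phi_comp ξ y).div_const _)).intervalIntegrable _ _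
  · exact continuous_const.intervalIntegrable _ _

theorem integral_density_split (ξ y l : ℝ) :
    mass ξ y l = mass ξ y π - ∫ x in l..π, density ξ y x := by
  have h := continuous_density ξ y
  rw [eq_sub_iff_add_eq]
  exact integral_add_adjacent_intervals (h.intervalIntegrable _ _) (h.intervalIntegrable _ _)

theorem mass_reflect (ξ y l : ℝ) : mass ξ y l = mass ξ y π - mass (-ξ) y (π - l) := by
  rw [integral_density_split]
  congr 1
  unfold mass
  simp_rw [← density_pi_sub]
  rw [intervalIntegral.integral_comp_sub_left (density ξ y) π]
  simp

/-- When both ends 0 and l of the arc face the point, the whole arc does, so the positive part can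
be dropped and `phi` gives a primitive. -/
theorem mass_of_front {ξ y l : ℝ} (hl : 0 ≤ l) (hlπ : l < π) (hξ : 0 ≤ ξ)
    (hf : 0 ≤ ξ * cos l + y * sin l) :
    mass ξ y l = (phi (ξ * sin l - y * cos l) + phi y) / 2 +
      (1 - phi (√(ξ ^ 2 + y ^ 2))) * l / (2 * π) := by
  unfold mass
  rw [intervalIntegral.integral_congr (g := fun x => dphi (ξ * sin x - y * cos x) * (ξ * cos x + y * sin x) / 2 +
    (1 - phi (√(ξ ^ 2 + y ^ 2))) / (2 * π)), intervalIntegral.integral_add, intervalIntegral.integral_div, integral_deriv_phi_comp,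
    intervalIntegral.integral_const]
  · simp only [sin_zero, cos_zero]
    norm_num [phi_neg]
    field_simp
  · exact ((continuous_deriv_phi_comp ξ y).div_const _).intervalIntegrable _ _
  · exact continuous_const.intervalIntegrable _ _
  · intro x hx
    rw [uIcc_of_le hl] at hx
    simp only [density]
    rcases hl.eq_or_lt with rfl | hl
    · obtain rfl : x = 0 := le_antisymm hx.2 hx.1
      simp [hξ]
    rw [max_eq_left]
    have h1 : (ξ * cos x + y * sin x) * sin l =
        ξ * sin (l - x) + (ξ * cos l + y * sin l) * sin x := by
      rw [sin_sub]; ring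
    have h2 : 0 < sin l := sin_pos_of_pos_of_lt_pi hl hlπ
    refine nonneg_of_mul_nonneg_left ?_ h2
    rw [h1]
    have h3 : 0 ≤ sin (l - x) := sin_nonneg_of_nonneg_of_le_pi (by linarith [hx.2])
      (by linarith [hx.1])
    have h4 : 0 ≤ sin x := sin_nonneg_of_nonneg_of_le_pi hx.1 (by linarith [hx.2])
    positivity

/-- Here the arc from l to π lies entirely on the far side and carries only the uniform part. -/
theorem mass_of_back {ξ y l : ℝ} (hl : 0 < l) (hlπ : l < π) (hξ : 0 ≤ ξ)
    (hf : ξ * cos l + y * sin l ≤ 0) :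
    mass ξ y l = (1 + phi y) / 2 - (1 - phi (√(ξ ^ 2 + y ^ 2))) * (π - l) / (2 * π) := by
  rw [integral_density_split, mass_pi]
  congr 1
  rw [intervalIntegral.integral_congr (g := fun x => (1 - phi (√(ξ ^ 2 + y ^ 2))) / (2 * π)), intervalIntegral.integral_const]
  · simp only [smul_eq_mul]; ring
  · intro x hx
    rw [uIcc_of_le hlπ.le] at hx
    simp only [density]
    rw [max_eq_right]
    · simp
    have h1 : (ξ * cos x + y * sin x) * sin l =
        -(ξ * sin (x - l)) + (ξ * cos l + y * sin l) * sin x := by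
      rw [sin_sub]; ring
    have h2 : 0 < sin l := sin_pos_of_pos_of_lt_pi hl hlπ
    have h3 : 0 ≤ sin (x - l) := sin_nonneg_of_nonneg_of_le_pi (by linarith [hx.1])
      (by linarith [hx.2])
    have h4 : 0 ≤ sin x := sin_nonneg_of_nonneg_of_le_pi (by linarith [hx.1]) hx.2
    have : (ξ * cos x + y * sin x) * sin l ≤ 0 := by
      rw [h1]; nlinarith [mul_nonneg hξ h3, mul_nonneg (neg_nonneg.2 hf) h4]
    exact nonpos_of_mul_nonpos_left this h2

/-- As ξ grows the uniform part loses mass; this bound lets the gain in the concentrated part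
outweigh the loss. Up to π/2 it follows from Jordan's inequality. Beyond π/2 the facing condition
gives ξ|cos l| ≤ y sin l, hence ξ² ≤ (ξ² + y²) sin² l. -/
theorem front_ineq {ξ y l : ℝ} (hl : 0 ≤ l) (hlπ : l < π) (hξ : 0 < ξ)
    (hf : 0 ≤ ξ * cos l + y * sin l) : ξ / √(ξ ^ 2 + y ^ 2) * (l / π) ≤ sin l := by
  have hρ : 0 < √(ξ ^ 2 + y ^ 2) := by positivity
  have h1 : ξ / √(ξ ^ 2 + y ^ 2) ≤ 1 := by
    rw [div_le_one hρ]; exact le_sqrt_of_sq_le (by nlinarith)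
  have hlp : 0 ≤ l / π := by positivity
  rcases le_or_gt l (π / 2) with h | h
  · have h2 := mul_le_sin hl h
    have h3 : 2 / π * l = 2 * (l / π) := by ring
    nlinarith
  · have hc : cos l < 0 := cos_neg_of_pi_div_two_lt_of_lt h (by linarith)
    have hs : 0 < sin l := sin_pos_of_pos_of_lt_pi (by linarith [pi_pos]) hlπ
    have h4 : ξ / √(ξ ^ 2 + y ^ 2) ≤ sin l := by
      rw [div_le_iff₀ hρ, ← sqrt_sq hs.le, ← sqrt_mul (sq_nonneg _)]
      apply le_sqrt_of_sq_le
      have h5 : (ξ * cos l) ^ 2 ≤ (y * sin l) ^ 2 := by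
        rw [sq_le_sq, abs_of_neg (mul_neg_of_pos_of_neg hξ hc)]
        exact le_trans (by linarith) (le_abs_self _)
      nlinarith [sin_sq_add_cos_sq l]
    have h6 : l / π ≤ 1 := by rw [div_le_one pi_pos]; exact hlπ.le
    have h7 : 0 ≤ ξ / √(ξ ^ 2 + y ^ 2) := by positivity
    nlinarith

theorem front_mono {ξ₁ ξ₂ y l : ℝ} (hl : 0 ≤ l) (hlπ : l < π) (h₁ : 0 ≤ ξ₁) (h₁₂ : ξ₁ ≤ ξ₂)
    (hf₁ : 0 ≤ ξ₁ * cos l + y * sin l) (hf₂ : 0 ≤ ξ₂ * cos l + y * sin l) :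
    mass ξ₁ y l ≤ mass ξ₂ y l := by
  rw [mass_of_front hl hlπ h₁ hf₁, mass_of_front hl hlπ (h₁.trans h₁₂) hf₂]
  let f : ℝ → ℝ := fun ξ => (phi (ξ * sin l - y * cos l) + phi y) / 2 +
      (1 - phi (√(ξ ^ 2 + y ^ 2))) * l / (2 * π)
  have hfc : Continuous f := by
    have := continuous_phi
    fun_prop
  -- At ξ = 0 the root fails to be differentiable when y = 0; continuity of `f` takes care of that
  -- endpoint.
  have hd : ∀ ξ, 0 < ξ → HasDerivAt f (dphi (ξ * sin l - y * cos l) * sin l / 2 +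
      -(dphi (√(ξ ^ 2 + y ^ 2)) * (ξ / √(ξ ^ 2 + y ^ 2))) * l / (2 * π)) ξ := by
    intro ξ hξ
    have e1 : HasDerivAt (fun ξ => phi (ξ * sin l - y * cos l))
        (dphi (ξ * sin l - y * cos l) * sin l) ξ := by
      refine (hasDerivAt_phi _).comp ξ (h := fun ξ => ξ * sin l - y * cos l) ?_
      simpa using ((hasDerivAt_id ξ).mul_const (sin l)).sub_const (y * cos l)
    have e2 : HasDerivAt (fun ξ => √(ξ ^ 2 + y ^ 2)) (ξ / √(ξ ^ 2 + y ^ 2)) ξ := by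
      have hne : ξ ^ 2 + y ^ 2 ≠ 0 := by positivity
      refine (((hasDerivAt_pow 2 ξ).add_const (y ^ 2)).sqrt hne).congr_deriv ?_
      field_simp
      simp
    have e3 := (hasDerivAt_phi (√(ξ ^ 2 + y ^ 2))).comp ξ e2
    exact ((e1.add_const (phi y)).div_const 2).add
      ((e3.const_sub 1).mul_const l |>.div_const (2 * π))
  have hmono : MonotoneOn f (Icc ξ₁ ξ₂) := by
    refine monotoneOn_of_deriv_nonneg (convex_Icc _ _) hfc.continuousOn
      (fun ξ hξ => ?_) (fun ξ hξ => ?_)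
    · rw [interior_Icc] at hξ
      exact (hd ξ (h₁.trans_lt hξ.1)).differentiableAt.differentiableWithinAt
    · rw [interior_Icc] at hξ
      have hpos := h₁.trans_lt hξ.1
      rw [(hd ξ hpos).deriv]
      -- The facing condition is affine in ξ, so it passes from the endpoints to the points between
      -- them.
      have hf : 0 ≤ ξ * cos l + y * sin l := by
        rcases le_total 0 (cos l) with hc | hc
        · nlinarith [hξ.1]
        · nlinarith [hξ.2]
      have hi := front_ineq hl hlπ hpos hf
      have hle : dphi (√(ξ ^ 2 + y ^ 2)) ≤ dphi (ξ * sin l - y * cos l) := by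
        refine dphi_le_dphi ?_
        rw [sq_sqrt (by positivity)]
        nlinarith [sq_nonneg (ξ * cos l + y * sin l), sin_sq_add_cos_sq l,
          mul_self_nonneg ξ]
      have hs : 0 ≤ sin l := sin_nonneg_of_nonneg_of_le_pi hl hlπ.le
      have h3 : dphi (√(ξ ^ 2 + y ^ 2)) * (ξ / √(ξ ^ 2 + y ^ 2) * (l / π)) ≤
          dphi (ξ * sin l - y * cos l) * sin l :=
        (mul_le_mul_of_nonneg_left hi (dphi_pos _).le).trans (mul_le_mul_of_nonneg_right hle hs)
      have h4 : -(dphi (√(ξ ^ 2 + y ^ 2)) * (ξ / √(ξ ^ 2 + y ^ 2))) * l / (2 * π) =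
          -(dphi (√(ξ ^ 2 + y ^ 2)) * (ξ / √(ξ ^ 2 + y ^ 2) * (l / π))) / 2 := by
        field_simp
      rw [h4]; linarith
  exact hmono ⟨le_rfl, h₁₂⟩ ⟨h₁₂, le_rfl⟩ h₁₂

/-- The uniform mass on the complementary arc decreases with ξ while the mass of the half circle
stays fixed. -/
theorem back_mono {ξ₁ ξ₂ y l : ℝ} (hl : 0 < l) (hlπ : l < π) (h₁ : 0 ≤ ξ₁) (h₁₂ : ξ₁ ≤ ξ₂)
    (hf₁ : ξ₁ * cos l + y * sin l ≤ 0) (hf₂ : ξ₂ * cos l + y * sin l ≤ 0) :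
    mass ξ₁ y l ≤ mass ξ₂ y l := by
  rw [mass_of_back hl hlπ h₁ hf₁, mass_of_back hl hlπ (h₁.trans h₁₂) hf₂]
  have : phi (√(ξ₁ ^ 2 + y ^ 2)) ≤ phi (√(ξ₂ ^ 2 + y ^ 2)) :=
    strictMono_phi.monotone (by gcongr)
  have h2 : 0 ≤ π - l := by linarith
  gcongr

theorem mass_mono_of_nonneg {ξ₁ ξ₂ y l : ℝ} (hl : 0 ≤ l) (hlπ : l ≤ π) (h₁ : 0 ≤ ξ₁)
    (h₁₂ : ξ₁ ≤ ξ₂) : mass ξ₁ y l ≤ mass ξ₂ y l := by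
  rcases hlπ.eq_or_lt with rfl | hlπ
  · rw [mass_pi, mass_pi]
  rcases hl.eq_or_lt with rfl | hl'
  · simp [mass]
  have hs : 0 < sin l := sin_pos_of_pos_of_lt_pi hl' hlπ
  rcases le_total 0 (ξ₁ * cos l + y * sin l) with hf₁ | hf₁ <;>
    rcases le_total 0 (ξ₂ * cos l + y * sin l) with hf₂ | hf₂
  · exact front_mono hl hlπ h₁ h₁₂ hf₁ hf₂
  -- At the intermediate η the angle l sits on the edge of the facing half circle, where the front
  -- and back estimates both apply.
  · obtain ⟨η, hη, h0⟩ : ∃ η ∈ Icc ξ₁ ξ₂, η * cos l + y * sin l = 0 :=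
      intermediate_value_Icc' h₁₂ (f := fun η => η * cos l + y * sin l)
        (by fun_prop) ⟨hf₂, hf₁⟩
    exact (front_mono hl hlπ h₁ hη.1 hf₁ h0.ge).trans
      (back_mono hl' hlπ (h₁.trans hη.1) hη.2 h0.le hf₂)
  · obtain ⟨η, hη, h0⟩ : ∃ η ∈ Icc ξ₁ ξ₂, η * cos l + y * sin l = 0 :=
      intermediate_value_Icc h₁₂ (f := fun η => η * cos l + y * sin l)
        (by fun_prop) ⟨hf₁, hf₂⟩
    exact (back_mono hl' hlπ h₁ hη.1 hf₁ h0.le).trans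
      (front_mono hl hlπ (h₁.trans hη.1) hη.2 h0.ge hf₂)
  · exact back_mono hl' hlπ h₁ h₁₂ hf₁ hf₂

/-- When a point moves along a great circle, the mass of an arc starting from the endpoint it
approaches increases. -/
theorem mass_mono {ξ₁ ξ₂ y l : ℝ} (hl : 0 ≤ l) (hlπ : l ≤ π) (h₁₂ : ξ₁ ≤ ξ₂) :
    mass ξ₁ y l ≤ mass ξ₂ y l := by
  -- The reflection x ↦ π - x changes the sign of ξ and replaces the arc by its complement in the
  -- half circle, so the order is preserved.
  have key : ∀ ξ₁ ξ₂ : ℝ, ξ₁ ≤ ξ₂ → ξ₂ ≤ 0 → mass ξ₁ y l ≤ mass ξ₂ y l := by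
    intro ξ₁ ξ₂ h h0
    rw [mass_reflect, mass_reflect ξ₂, mass_pi, mass_pi]
    linarith [mass_mono_of_nonneg (y := y) (l := π - l) (by linarith) (by linarith)
      (neg_nonneg.2 h0) (neg_le_neg h)]
  rcases le_total 0 ξ₁ with h1 | h1
  · exact mass_mono_of_nonneg hl hlπ h1 h₁₂
  rcases le_total 0 ξ₂ with h2 | h2
  · exact (key _ _ h1 le_rfl).trans (mass_mono_of_nonneg hl hlπ le_rfl h2)
  · exact key _ _ h₁₂ h2

/-! ### Mean distance of the density to a boundary point -/

/-- The spherical distance from the point with gnomonic coordinates `(ξ, y)` to the point at angle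
`0` of the equator. -/
def distZero (ξ y : ℝ) : ℝ := arccos (ξ / √(1 + ξ ^ 2 + y ^ 2))

/-- The function differentiated is the spherical distance to the boundary point at angle x. The
nonuniform part of `density` is therefore half the positive part of its second derivative. -/
theorem hasDerivAt_arccos_comp (ξ y x : ℝ) :
    HasDerivAt (fun x => arccos ((ξ * cos x + y * sin x) / √(1 + ξ ^ 2 + y ^ 2)))
      (phi (ξ * sin x - y * cos x)) x := by
  set N := √(1 + ξ ^ 2 + y ^ 2) with hN
  have hN2 : N ^ 2 = 1 + ξ ^ 2 + y ^ 2 := sq_sqrt (by positivity)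
  have hNpos : 0 < N := sqrt_pos.2 (by positivity)
  set u := ξ * cos x + y * sin x with hu
  set z := ξ * sin x - y * cos x with hz
  have huz : N ^ 2 = 1 + u ^ 2 + z ^ 2 := by
    rw [hN2, hu, hz]
    linear_combination (-(ξ ^ 2 + y ^ 2)) * sin_sq_add_cos_sq x
  have hlt : |u| < N := by
    apply abs_lt_of_sq_lt_sq _ hNpos.le
    nlinarith [sq_nonneg z]
  have hlt' := abs_lt.1 hlt
  have h1 : u / N ≠ -1 := by
    intro h; rw [div_eq_iff hNpos.ne'] at h; linarith
  have h2 : u / N ≠ 1 := by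
    intro h; rw [div_eq_iff hNpos.ne'] at h; linarith
  have hd : HasDerivAt (fun x => (ξ * cos x + y * sin x) / N) (-z / N) x := by
    refine ((((hasDerivAt_cos x).const_mul ξ).add
      ((hasDerivAt_sin x).const_mul y)).div_const N).congr_deriv ?_
    rw [hz]; ring
  refine ((hasDerivAt_arccos h1 h2).comp x hd).congr_deriv ?_
  have h3 : 1 - (u / N) ^ 2 = (1 + z ^ 2) / N ^ 2 := by
    field_simp; linarith
  rw [h3, sqrt_div' _ (sq_nonneg N), sqrt_sq hNpos.le, phi]
  have : 0 < √(1 + z ^ 2) := sqrt_pos.2 (one_add_sq_pos z)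
  field_simp

theorem integral_mul_deriv_phi_comp (ξ y : ℝ) :
    ∫ x in (0 : ℝ)..π, x * (dphi (ξ * sin x - y * cos x) * (ξ * cos x + y * sin x)) =
      π * phi y - (π - 2 * distZero ξ y) := by
  have h1 := integral_mul_deriv_eq_deriv_mul (a := 0) (b := π) (u := fun x => x) (u' := fun _ => 1)
    (fun x _ => hasDerivAt_id x) (fun x _ => hasDerivAt_phi_comp ξ y x)
    (continuous_const.intervalIntegrable _ _)
    ((continuous_deriv_phi_comp ξ y).intervalIntegrable _ _)
  rw [h1]
  -- The spherical distances to the opposite angles 0 and π add up to π.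
  have h2 : ∫ x in (0 : ℝ)..π, phi (ξ * sin x - y * cos x) = π - 2 * distZero ξ y := by
    rw [integral_eq_sub_of_hasDerivAt (fun x _ => hasDerivAt_arccos_comp ξ y x)]
    · simp only [cos_pi, sin_pi, cos_zero, sin_zero, distZero]
      have : (ξ * -1 + y * 0) / √(1 + ξ ^ 2 + y ^ 2) = -(ξ / √(1 + ξ ^ 2 + y ^ 2)) := by ring
      rw [this, arccos_neg]
      norm_num
      ring
    · have := continuous_phi
      exact Continuous.intervalIntegrable (by fun_prop) _ _
  simp only [one_mul, h2]
  simp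

/-- The reflection x ↦ π - x turns the second integral into the first with weight π - x, and the two
weights add up to the constant π. -/
theorem integral_mul_abs_deriv_phi_comp (ξ y : ℝ) :
    (∫ x in (0 : ℝ)..π, x * (dphi (ξ * sin x - y * cos x) * |ξ * cos x + y * sin x|)) +
      (∫ x in (0 : ℝ)..π, x * (dphi (ξ * sin x - -y * cos x) * |ξ * cos x + -y * sin x|)) =
      2 * π * phi (√(ξ ^ 2 + y ^ 2)) := by
  have hc := continuous_abs_deriv_phi_comp ξ y
  have h1 : (∫ x in (0 : ℝ)..π, x * (dphi (ξ * sin x - -y * cos x) * |ξ * cos x + -y * sin x|)) =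
      ∫ x in (0 : ℝ)..π, (π - x) * (dphi (ξ * sin x - y * cos x) * |ξ * cos x + y * sin x|) := by
    have := intervalIntegral.integral_comp_sub_left (a := 0) (b := π)
      (fun x => (π - x) * (dphi (ξ * sin x - y * cos x) * |ξ * cos x + y * sin x|)) π
    rw [sub_self, sub_zero] at this
    rw [← this]
    refine intervalIntegral.integral_congr fun x _ => ?_
    simp only [sin_pi_sub, cos_pi_sub, sub_sub_cancel]
    rw [← abs_neg]
    congr 3 <;> ring
  rw [h1, ← intervalIntegral.integral_add (Continuous.intervalIntegrable (by fun_prop) _ _)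
    (Continuous.intervalIntegrable (by fun_prop) _ _)]
  have : ∀ x : ℝ, x * (dphi (ξ * sin x - y * cos x) * |ξ * cos x + y * sin x|) +
      (π - x) * (dphi (ξ * sin x - y * cos x) * |ξ * cos x + y * sin x|) =
      π * (dphi (ξ * sin x - y * cos x) * |ξ * cos x + y * sin x|) := fun x => by ring
  simp_rw [this]
  rw [intervalIntegral.integral_const_mul, integral_abs_deriv_phi_comp]
  ring

theorem integral_mul_density (ξ y : ℝ) :
    ∫ x in (0 : ℝ)..π, x * density ξ y x =
      (π * phi y - (π - 2 * distZero ξ y)) / 4 +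
      (∫ x in (0 : ℝ)..π, x * (dphi (ξ * sin x - y * cos x) * |ξ * cos x + y * sin x|)) / 4 +
      (1 - phi (√(ξ ^ 2 + y ^ 2))) * π / 4 := by
  have h1 := continuous_deriv_phi_comp ξ y
  have h2 := continuous_abs_deriv_phi_comp ξ y
  rw [← integral_mul_deriv_phi_comp]
  have : ∀ x, x * density ξ y x =
      x * (dphi (ξ * sin x - y * cos x) * (ξ * cos x + y * sin x)) / 4 +
      x * (dphi (ξ * sin x - y * cos x) * |ξ * cos x + y * sin x|) / 4 +
      x * ((1 - phi (√(ξ ^ 2 + y ^ 2))) / (2 * π)) := fun x => by rw [density_eq]; ring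
  simp_rw [this]
  rw [intervalIntegral.integral_add, intervalIntegral.integral_add, intervalIntegral.integral_div, intervalIntegral.integral_div, intervalIntegral.integral_mul_const, integral_id]
  · congr 1
    field_simp
    ring
  all_goals exact Continuous.intervalIntegrable (by fun_prop) _ _

/-- The mean distance from angle `0` with respect to the density is the spherical distance. -/
theorem integral_mul_density_add (ξ y : ℝ) :
    (∫ x in (0 : ℝ)..π, x * density ξ y x) + (∫ x in (0 : ℝ)..π, x * density ξ (-y) x) =
      distZero ξ y := by
  have h := integral_mul_abs_deriv_phi_comp ξ y
  have hd : distZero ξ (-y) = distZero ξ y := by simp [distZero]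
  rw [integral_mul_density, integral_mul_density, hd, phi_neg, neg_sq]
  linear_combination h / 4

theorem hasDerivAt_mass (ξ y l : ℝ) : HasDerivAt (mass ξ y) (density ξ y l) l :=
  (continuous_density ξ y).integral_hasStrictDerivAt 0 l |>.hasDerivAt

theorem continuous_mass (ξ y : ℝ) : Continuous (mass ξ y) :=
  continuous_iff_continuousAt.2 fun z => (hasDerivAt_mass ξ y z).continuousAt

/-- Integration by parts converts areas under distribution functions, which measure transport cost,
into first moments. -/
theorem integral_mass (ξ y : ℝ) :
    ∫ x in (0 : ℝ)..π, (mass ξ y π - mass ξ y x) = ∫ x in (0 : ℝ)..π, x * density ξ y x := by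
  have h1 := integral_mul_deriv_eq_deriv_mul (a := 0) (b := π) (u := fun x => x) (u' := fun _ => 1)
    (fun x _ => hasDerivAt_id x) (fun x _ => hasDerivAt_mass ξ y x)
    (continuous_const.intervalIntegrable _ _)
    ((continuous_density ξ y).intervalIntegrable _ _)
  rw [h1, intervalIntegral.integral_sub (continuous_const.intervalIntegrable _ _)
    ((continuous_mass ξ y).intervalIntegrable _ _)]
  simp

end

end QuadIsop

namespace QuadIsop

universe u

noncomputable section

open Real ProbabilityTheory Filter Topology

/-! ### The probability measures and their Wasserstein distances -/

/-- The probability measure on the fundamental domain `(-π, π]` with the given density. -/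
def arcMeasure (ξ y : ℝ) : Measure ℝ :=
  (volume.restrict (Ioc (-π) π)).withDensity fun x => ENNReal.ofReal (density ξ y x)

theorem mass_neg (ξ y l : ℝ) : mass ξ y (-l) = -mass ξ (-y) l := by
  unfold mass
  simp_rw [← density_neg]
  rw [intervalIntegral.integral_comp_neg (density ξ y), neg_zero, intervalIntegral.integral_symm]

theorem integral_density_from (ξ y x : ℝ) :
    ∫ t in (-π)..x, density ξ y t = (1 - phi y) / 2 + mass ξ y x := by
  have h := continuous_density ξ y
  rw [← intervalIntegral.integral_add_adjacent_intervals (h.intervalIntegrable (-π) 0)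
    (h.intervalIntegrable 0 x)]
  congr 1
  rw [intervalIntegral.integral_symm]
  change -mass ξ y (-π) = _
  rw [mass_neg, neg_neg, mass_pi, phi_neg]; ring

theorem arcMeasure_Ioc {ξ y x : ℝ} (hx : -π ≤ x) (hxπ : x ≤ π) :
    arcMeasure ξ y (Iic x) = ENNReal.ofReal ((1 - phi y) / 2 + mass ξ y x) := by
  rw [arcMeasure, withDensity_apply _ measurableSet_Iic, Measure.restrict_restrict measurableSet_Iic]
  have : Iic x ∩ Ioc (-π) π = Ioc (-π) x := by
    ext t; simp only [mem_inter_iff, mem_Iic, mem_Ioc]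
    exact ⟨fun h => ⟨h.2.1, h.1⟩, fun h => ⟨h.2, h.1, h.2.trans hxπ⟩⟩
  rw [this, ← integral_density_from, intervalIntegral.integral_of_le hx,
    ofReal_integral_eq_lintegral_ofReal]
  · exact ((continuous_density ξ y).intervalIntegrable (-π) x).1
  · exact Eventually.of_forall fun t => density_nonneg ξ y t

theorem arcMeasure_Iic_pi (ξ y : ℝ) : arcMeasure ξ y (Iic π) = 1 := by
  rw [arcMeasure_Ioc (by linarith [pi_pos]) le_rfl, mass_pi]
  convert ENNReal.ofReal_one using 2; ring

theorem arcMeasure_compl (ξ y : ℝ) : arcMeasure ξ y (Iic π)ᶜ = 0 := by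
  rw [arcMeasure]
  refine withDensity_absolutelyContinuous _ _ ?_
  rw [Measure.restrict_apply measurableSet_Iic.compl]
  convert measure_empty (μ := volume)
  ext t; simp +contextual

instance (ξ y : ℝ) : IsProbabilityMeasure (arcMeasure ξ y) :=
  ⟨by rw [← measure_add_measure_compl (measurableSet_Iic (a := π)), arcMeasure_Iic_pi,
    arcMeasure_compl, add_zero]⟩

theorem cdf_arcMeasure {ξ y x : ℝ} (hx : -π ≤ x) (hxπ : x ≤ π) :
    cdf (arcMeasure ξ y) x = (1 - phi y) / 2 + mass ξ y x := by
  rw [cdf_eq_real, measureReal_def, arcMeasure_Ioc hx hxπ, ENNReal.toReal_ofReal]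
  rw [← integral_density_from]
  exact intervalIntegral.integral_nonneg hx fun t _ => density_nonneg ξ y t

theorem cdf_arcMeasure_of_lt {ξ y x : ℝ} (hx : x < -π) : cdf (arcMeasure ξ y) x = 0 := by
  refine le_antisymm ?_ (cdf_nonneg _ _)
  refine (monotone_cdf _ hx.le).trans ?_
  rw [cdf_arcMeasure le_rfl (by linarith [pi_pos]), ← integral_density_from,
    intervalIntegral.integral_same]

theorem cdf_arcMeasure_of_gt {ξ y x : ℝ} (hx : π < x) : cdf (arcMeasure ξ y) x = 1 := by
  refine le_antisymm (cdf_le_one _ _) ?_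
  refine le_trans ?_ (monotone_cdf _ hx.le)
  rw [cdf_arcMeasure (by linarith [pi_pos]) le_rfl, mass_pi]
  linarith

theorem lintegral_abs_le {F A B : ℝ → ℝ} (hA : Continuous A) (hB : Continuous B)
    (h0 : ∀ x, x ∉ Icc (-π) π → F x = 0) (h1 : ∀ x ∈ Icc 0 π, |F x| = A x)
    (h2 : ∀ x ∈ Ioc 0 π, |F (-x)| = B x) :
    ∫⁻ x, ENNReal.ofReal |F x| ≤
      ENNReal.ofReal ((∫ x in (0 : ℝ)..π, A x) + ∫ x in (0 : ℝ)..π, B x) := by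
  have key : ∀ {C : ℝ → ℝ}, Continuous C → (∀ x ∈ Ioc 0 π, 0 ≤ C x) →
      ∫⁻ x, (Ioc 0 π).indicator (fun x => ENNReal.ofReal (C x)) x =
        ENNReal.ofReal (∫ x in (0 : ℝ)..π, C x) := by
    intro C hC hC0
    rw [lintegral_indicator measurableSet_Ioc, intervalIntegral.integral_of_le pi_pos.le,
      ofReal_integral_eq_lintegral_ofReal (hC.intervalIntegrable 0 π).1]
    exact (ae_restrict_iff' measurableSet_Ioc).2 (Eventually.of_forall hC0)
  have hA0 : ∀ x ∈ Ioc 0 π, 0 ≤ A x := fun x hx => h1 x ⟨hx.1.le, hx.2⟩ ▸ abs_nonneg _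
  have hB0 : ∀ x ∈ Ioc 0 π, 0 ≤ B x := fun x hx => h2 x hx ▸ abs_nonneg _
  have i0 : ∀ {C : ℝ → ℝ}, (∀ x ∈ Ioc 0 π, 0 ≤ C x) → 0 ≤ ∫ x in (0 : ℝ)..π, C x := by
    intro C hC0
    rw [intervalIntegral.integral_of_le pi_pos.le]
    exact setIntegral_nonneg measurableSet_Ioc hC0
  rw [ENNReal.ofReal_add (i0 hA0) (i0 hB0), ← key hA hA0, ← key hB hB0]
  rw [← lintegral_neg_eq_self (μ := volume)
    ((Ioc 0 π).indicator fun x => ENNReal.ofReal (B x))]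
  have hm : Measurable ((Ioc 0 π).indicator fun x => ENNReal.ofReal (A x)) :=
    hA.measurable.ennreal_ofReal.indicator measurableSet_Ioc
  rw [← lintegral_add_left hm]
  refine lintegral_mono_ae ?_
  have h00 : ∀ᵐ x : ℝ, x ≠ 0 := by simp [ae_iff]
  filter_upwards [h00] with x hx0
  by_cases hx : x ∈ Icc (-π) π
  · rcases lt_or_gt_of_ne hx0 with h | h
    · have hm : -x ∈ Ioc 0 π := ⟨by linarith, by linarith [hx.1]⟩
      have := h2 _ hm
      rw [neg_neg] at this
      rw [indicator_of_mem hm, ← this]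
      exact le_add_self
    · have hm : x ∈ Ioc 0 π := ⟨h, hx.2⟩
      rw [indicator_of_mem hm, h1 x ⟨h.le, hx.2⟩]
      exact le_self_add
  · simp [h0 x hx]

/-- By `mass_mono` the difference of the distribution functions has a constant sign on each side of
0. The absolute values can then be removed, which leaves the difference of the mean distances to 0.
-/
theorem lintegral_cdf_sub_le {ξ₁ ξ₂ : ℝ} (y : ℝ) (h : ξ₁ ≤ ξ₂) :
    ∫⁻ x, ENNReal.ofReal |cdf (arcMeasure ξ₁ y) x - cdf (arcMeasure ξ₂ y) x| ≤
      ENNReal.ofReal (distZero ξ₁ y - distZero ξ₂ y) := by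
  have hc : ∀ ξ y, Continuous (mass ξ y) := continuous_mass
  refine (lintegral_abs_le (A := fun x => (mass ξ₁ y π - mass ξ₁ y x) - (mass ξ₂ y π - mass ξ₂ y x))
    (B := fun x => (mass ξ₁ (-y) π - mass ξ₁ (-y) x) - (mass ξ₂ (-y) π - mass ξ₂ (-y) x))
    (by fun_prop) (by fun_prop) ?_ ?_ ?_).trans ?_
  · intro x hx
    rcases lt_or_ge x (-π) with h1 | h1
    · rw [cdf_arcMeasure_of_lt h1, cdf_arcMeasure_of_lt h1, sub_zero]
    · have h2 : π < x := by by_contra! h2; exact hx ⟨h1, h2⟩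
      rw [cdf_arcMeasure_of_gt h2, cdf_arcMeasure_of_gt h2, sub_self]
  · intro x hx
    rw [cdf_arcMeasure (by linarith [hx.1, pi_pos]) hx.2,
      cdf_arcMeasure (by linarith [hx.1, pi_pos]) hx.2, mass_pi, mass_pi, abs_of_nonpos]
    · ring
    · linarith [mass_mono (y := y) hx.1 hx.2 h]
  · intro x hx
    rw [cdf_arcMeasure (by linarith [hx.2]) (by linarith [hx.1, pi_pos]),
      cdf_arcMeasure (by linarith [hx.2]) (by linarith [hx.1, pi_pos]), mass_neg, mass_neg,
      mass_pi, mass_pi, abs_of_nonneg]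
    · ring
    · linarith [mass_mono (y := -y) hx.1.le hx.2 h]
  · have hs : ∀ y, ∫ x in (0 : ℝ)..π, ((mass ξ₁ y π - mass ξ₁ y x) - (mass ξ₂ y π - mass ξ₂ y x)) =
        (∫ x in (0 : ℝ)..π, x * density ξ₁ y x) - ∫ x in (0 : ℝ)..π, x * density ξ₂ y x := by
      intro y
      rw [← integral_mass, ← integral_mass]
      exact intervalIntegral.integral_sub (Continuous.intervalIntegrable (by fun_prop) _ _)
        (Continuous.intervalIntegrable (by fun_prop) _ _)
    rw [hs, hs, ← integral_mul_density_add ξ₁, ← integral_mul_density_add ξ₂]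
    refine ENNReal.ofReal_le_ofReal (le_of_eq ?_); ring

theorem lintegral_cdf_dirac_sub_le (ξ y : ℝ) :
    ∫⁻ x, ENNReal.ofReal |cdf (Measure.dirac 0) x - cdf (arcMeasure ξ y) x| ≤
      ENNReal.ofReal (distZero ξ y) := by
  have hc : ∀ ξ y, Continuous (mass ξ y) := continuous_mass
  have hd1 : ∀ x : ℝ, 0 ≤ x → cdf (Measure.dirac 0) x = 1 := fun x hx => by
    rw [cdf_eq_real, measureReal_def, Measure.dirac_apply_of_mem (mem_Iic.2 hx)]; simp
  have hd0 : ∀ x : ℝ, x < 0 → cdf (Measure.dirac 0) x = 0 := fun x hx => by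
    rw [cdf_eq_real, measureReal_def, Measure.dirac_apply' _ measurableSet_Iic,
      indicator_of_notMem (by simpa using hx)]; simp
  refine (lintegral_abs_le (A := fun x => mass ξ y π - mass ξ y x)
    (B := fun x => mass ξ (-y) π - mass ξ (-y) x)
    (by fun_prop) (by fun_prop) ?_ ?_ ?_).trans ?_
  · intro x hx
    rcases lt_or_ge x (-π) with h1 | h1
    · rw [cdf_arcMeasure_of_lt h1, hd0 _ (by linarith [pi_pos]), sub_zero]
    · have h2 : π < x := by by_contra! h2; exact hx ⟨h1, h2⟩
      rw [cdf_arcMeasure_of_gt h2, hd1 _ (by linarith [pi_pos]), sub_self]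
  · intro x hx
    have := cdf_le_one (arcMeasure ξ y) x
    rw [abs_of_nonneg (by rw [hd1 _ hx.1]; linarith), hd1 _ hx.1,
      cdf_arcMeasure (by linarith [hx.1, pi_pos]) hx.2, mass_pi]
    ring
  · intro x hx
    have := cdf_nonneg (arcMeasure ξ y) (-x)
    rw [abs_of_nonpos (by rw [hd0 _ (by linarith [hx.1])]; linarith),
      hd0 _ (by linarith [hx.1]),
      cdf_arcMeasure (by linarith [hx.2]) (by linarith [hx.1, pi_pos]), mass_neg, mass_pi, phi_neg]
    ring
  · rw [integral_mass, integral_mass, integral_mul_density_add]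

variable {X : Type u} [MetricSpace X] [MeasurableSpace X] [BorelSpace X]

/-- Curve and density have period 2π, so the measure may be cut at any angle; the cut is placed
opposite to a. -/
theorem map_arcMeasure_rotate {γ : ℝ → X} (hγ : Continuous γ) (hper : Function.Periodic γ (2 * π))
    (ξ y a : ℝ) :
    (arcMeasure ξ y).map γ =
      (arcMeasure (ξ * cos a + y * sin a) (y * cos a - ξ * sin a)).map fun x => γ (a + x) := by
  have hγ' : Continuous fun x => γ (a + x) := by fun_prop
  ext B hB
  rw [Measure.map_apply hγ.measurable hB, Measure.map_apply hγ'.measurable hB, arcMeasure,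
    arcMeasure, withDensity_apply _ (hγ.measurable hB), withDensity_apply _ (hγ'.measurable hB),
    ← lintegral_indicator (hγ.measurable hB), ← lintegral_indicator (hγ'.measurable hB)]
  let f : ℝ → ℝ≥0∞ := (γ ⁻¹' B).indicator fun x => ENNReal.ofReal (density ξ y x)
  have hf : Function.Periodic f (2 * π) := by
    intro x
    have : x + 2 * π ∈ γ ⁻¹' B ↔ x ∈ γ ⁻¹' B := by rw [mem_preimage, hper x, mem_preimage]
    by_cases hx : x ∈ γ ⁻¹' B
    · simp only [f, indicator_of_mem hx, indicator_of_mem (this.2 hx), density_periodic ξ y x]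
    · simp only [f, indicator_of_notMem hx, indicator_of_notMem (fun h => hx (this.1 h))]
  have h1 : (fun x => ((fun x => γ (a + x)) ⁻¹' B).indicator (fun x => ENNReal.ofReal (density
      (ξ * cos a + y * sin a) (y * cos a - ξ * sin a) x)) x) = fun x => f (a + x) := by
    funext x
    by_cases hx : a + x ∈ γ ⁻¹' B
    · simp only [f, indicator_of_mem hx, density_rotate]
      exact indicator_of_mem (s := (fun x => γ (a + x)) ⁻¹' B) hx _
    · simp only [f, indicator_of_notMem hx]
      exact indicator_of_notMem (s := (fun x => γ (a + x)) ⁻¹' B) hx _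
  rw [h1]
  change ∫⁻ x in Ioc (-π) π, f x = _
  have d1 := isAddFundamentalDomain_Ioc (T := 2 * π) two_pi_pos (-π)
  have d2 := isAddFundamentalDomain_Ioc (T := 2 * π) two_pi_pos (a + -π)
  rw [show -π + 2 * π = π by ring] at d1
  rw [show a + -π + 2 * π = a + π by ring] at d2
  have h2 : ∫⁻ x in Ioc (-π) π, f x = ∫⁻ x in Ioc (a + -π) (a + π), f x := by
    refine d1.setLIntegral_eq d2 f ?_
    rintro ⟨g, hg⟩ x
    obtain ⟨n, rfl⟩ := AddSubgroup.mem_zmultiples_iff.1 hg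
    change f (n • (2 * π) + x) = f x
    rw [add_comm]
    simpa using hf.zsmul n x
  rw [h2]
  have := (measurePreserving_add_left volume a).setLIntegral_comp_preimage_emb
    (measurableEmbedding_addLeft a) f (Ioc (a + -π) (a + π))
  rw [← this]
  congr 2
  ext x; simp

/-! ### Transport cost bounded by spherical distance -/

/-- The spherical distance between two points of the hemisphere in gnomonic coordinates. -/
def sphericalDist (ξ₁ y₁ ξ₂ y₂ : ℝ) : ℝ :=
  arccos ((1 + ξ₁ * ξ₂ + y₁ * y₂) / (√(1 + ξ₁ ^ 2 + y₁ ^ 2) * √(1 + ξ₂ ^ 2 + y₂ ^ 2)))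

/-- Points with equal y lie on a great circle through angle 0, so the triangle inequality is an
equality. -/
theorem distZero_sub {ξ₁ ξ₂ : ℝ} (y : ℝ) (h' : 0 ≤ distZero ξ₁ y - distZero ξ₂ y) :
    distZero ξ₁ y - distZero ξ₂ y = sphericalDist ξ₁ y ξ₂ y := by
  have hN : ∀ ξ : ℝ, 0 < √(1 + ξ ^ 2 + y ^ 2) := fun ξ => sqrt_pos.2 (by positivity)
  have hN2 : ∀ ξ : ℝ, √(1 + ξ ^ 2 + y ^ 2) ^ 2 = 1 + ξ ^ 2 + y ^ 2 :=
    fun ξ => sq_sqrt (by positivity)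
  have hab : ∀ ξ : ℝ, |ξ / √(1 + ξ ^ 2 + y ^ 2)| ≤ 1 := by
    intro ξ
    rw [abs_div, abs_of_pos (hN ξ), div_le_one (hN ξ)]
    exact abs_le_sqrt (by nlinarith [sq_nonneg y])
  have hcos : ∀ ξ, cos (distZero ξ y) = ξ / √(1 + ξ ^ 2 + y ^ 2) := fun ξ =>
    cos_arccos (abs_le.1 (hab ξ)).1 (abs_le.1 (hab ξ)).2
  have hsin : ∀ ξ, sin (distZero ξ y) = √(1 + y ^ 2) / √(1 + ξ ^ 2 + y ^ 2) := by
    intro ξ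
    rw [distZero, sin_arccos, div_pow, hN2, ← sqrt_div (by positivity)]
    congr 1
    field_simp
    ring
  have hle : distZero ξ₁ y - distZero ξ₂ y ≤ π := by
    have h1 : distZero ξ₁ y ≤ π := arccos_le_pi _
    have h2 : 0 ≤ distZero ξ₂ y := arccos_nonneg _
    linarith
  rw [sphericalDist, ← arccos_cos h' hle, cos_sub, hcos, hcos, hsin, hsin]
  congr 1
  have h3 := hN ξ₁
  have h4 := hN ξ₂
  have h5 : √(1 + y ^ 2) ^ 2 = 1 + y ^ 2 := sq_sqrt (by positivity)
  field_simp
  linear_combination h5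

theorem distZero_antitone {ξ₁ ξ₂ : ℝ} (y : ℝ) (h : ξ₁ ≤ ξ₂) : distZero ξ₂ y ≤ distZero ξ₁ y := by
  refine arccos_le_arccos ?_
  have hN : ∀ ξ : ℝ, 0 < 1 + ξ ^ 2 + y ^ 2 := fun ξ => by positivity
  have e : ∀ ξ : ℝ, ξ / √(1 + ξ ^ 2 + y ^ 2) = phi (ξ / √(1 + y ^ 2)) := by
    intro ξ
    have h1 : 0 < √(1 + y ^ 2) := sqrt_pos.2 (one_add_sq_pos y)
    have h2 : 1 + (ξ / √(1 + y ^ 2)) ^ 2 = (1 + ξ ^ 2 + y ^ 2) / (1 + y ^ 2) := by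
      rw [div_pow, sq_sqrt (one_add_sq_pos y).le]
      have := one_add_sq_pos y
      field_simp; ring
    rw [phi, h2, sqrt_div (hN ξ).le]
    field_simp
  rw [e, e]
  exact strictMono_phi.monotone (by gcongr)

variable {γ : ℝ → X} {K : ℝ≥0}

/-- The push-forward of the arc measure under a Lipschitz curve. -/
def arcPoint (hγ : LipschitzWith K γ) (ξ y : ℝ) : WassersteinOne X :=
  WassersteinOne.map hγ (arcMeasure ξ y)
    ((lintegral_cdf_dirac_sub_le ξ y).trans_lt ENNReal.ofReal_lt_top).ne

theorem lipschitzWith_shift {X : Type u} [MetricSpace X] {γ : ℝ → X} {K : ℝ≥0}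
    (hγ : LipschitzWith K γ) (a : ℝ) :
    LipschitzWith K fun x => γ (a + x) := by
  intro x y
  simpa using hγ (a + x) (a + y)

theorem rotate_norm (ξ y a : ℝ) :
    1 + (ξ * cos a + y * sin a) ^ 2 + (y * cos a - ξ * sin a) ^ 2 = 1 + ξ ^ 2 + y ^ 2 := by
  linear_combination (ξ ^ 2 + y ^ 2) * sin_sq_add_cos_sq a

theorem wassersteinEDist_arcPoint_le (hγ : LipschitzWith K γ)
    (hper : Function.Periodic γ (2 * π)) (ξ₁ y₁ ξ₂ y₂ : ℝ) :
    wassersteinEDist (arcPoint hγ ξ₁ y₁).1 (arcPoint hγ ξ₂ y₂).1 ≤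
      K * ENNReal.ofReal (sphericalDist ξ₁ y₁ ξ₂ y₂) := by
  let w : ℂ := ⟨ξ₂ - ξ₁, y₂ - y₁⟩
  -- The direction of the segment joining the two points. After rotation by it they have equal
  -- second coordinates, and the second point is the one nearer to angle 0.
  set a := Complex.arg w
  have hx : ξ₂ - ξ₁ = ‖w‖ * cos a := (Complex.norm_mul_cos_arg w).symm
  have hy : y₂ - y₁ = ‖w‖ * sin a := (Complex.norm_mul_sin_arg w).symm
  have hyy : y₂ * cos a - ξ₂ * sin a = y₁ * cos a - ξ₁ * sin a := by
    linear_combination (cos a) * hy - (sin a) * hx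
  have hxx : ξ₁ * cos a + y₁ * sin a ≤ ξ₂ * cos a + y₂ * sin a := by
    have : ξ₂ * cos a + y₂ * sin a - (ξ₁ * cos a + y₁ * sin a) = ‖w‖ := by
      linear_combination (cos a) * hx + (sin a) * hy + ‖w‖ * sin_sq_add_cos_sq a
    linarith [norm_nonneg w]
  change wassersteinEDist ((arcMeasure ξ₁ y₁).map γ) ((arcMeasure ξ₂ y₂).map γ) ≤ _
  rw [map_arcMeasure_rotate hγ.continuous hper ξ₁ y₁ a,
    map_arcMeasure_rotate hγ.continuous hper ξ₂ y₂ a, hyy]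
  refine (wassersteinEDist_map_le (lipschitzWith_shift hγ a) _ _).trans ?_
  gcongr
  refine (lintegral_cdf_sub_le _ hxx).trans (le_of_eq ?_)
  rw [distZero_sub _ (sub_nonneg.2 (distZero_antitone _ hxx)), sphericalDist, sphericalDist,
    rotate_norm, ← hyy, rotate_norm]
  congr 3
  linear_combination (ξ₁ * ξ₂ + y₁ * y₂) * sin_sq_add_cos_sq a +
    (y₂ * cos a - ξ₂ * sin a) * hyy

/-- With a rotated to angle 0, transporting everything to the Dirac mass costs the mean distance,
which is the spherical distance. This gives continuity of the extension up to the equator. -/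
theorem wassersteinEDist_dirac_arcPoint_le (hγ : LipschitzWith K γ)
    (hper : Function.Periodic γ (2 * π)) (ξ y a : ℝ) :
    wassersteinEDist (Measure.dirac (γ a)) (arcPoint hγ ξ y).1 ≤
      K * ENNReal.ofReal (arccos ((ξ * cos a + y * sin a) / √(1 + ξ ^ 2 + y ^ 2))) := by
  change wassersteinEDist _ ((arcMeasure ξ y).map γ) ≤ _
  have h := lipschitzWith_shift hγ a
  have : Measure.dirac (γ a) = (Measure.dirac (0 : ℝ)).map fun x => γ (a + x) := by
    rw [Measure.map_dirac' h.continuous.measurable, add_zero]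
  rw [map_arcMeasure_rotate hγ.continuous hper ξ y a, this]
  refine (wassersteinEDist_map_le h _ _).trans ?_
  gcongr
  refine (lintegral_cdf_dirac_sub_le _ _).trans (le_of_eq ?_)
  rw [distZero, rotate_norm]

end

end QuadIsop

namespace QuadIsop

universe u

noncomputable section

open Real Filter Topology

/-! ### The Lipschitz extension to the hemisphere -/

section Subdivision

variable {X : Type u} [MetricSpace X]

theorem two_mul_arcsin_tendsto (δ : ℝ) :
    Tendsto (fun n : ℕ => (n : ℝ) * (2 * arcsin (δ / n / 2))) atTop (𝓝 δ) := by
  have h1 : HasDerivAt (fun t : ℝ => 2 * arcsin (t * δ / 2)) δ 0 := by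
    have h2 : HasDerivAt (fun t : ℝ => t * δ / 2) (δ / 2) 0 := by
      simpa using ((hasDerivAt_id (0 : ℝ)).mul_const δ).div_const 2
    have h3 : HasDerivAt arcsin 1 ((fun t : ℝ => t * δ / 2) 0) := by
      have := hasDerivAt_arcsin (x := 0) (by norm_num) (by norm_num)
      simpa using this
    have h4 := (h3.comp 0 h2).const_mul 2
    refine h4.congr_deriv ?_
    ring
  have h2 := h1.tendsto_slope_zero.comp
    (tendsto_inv_atTop_nhdsGT_zero.mono_right (nhdsWithin_mono _ fun x hx => ne_of_gt hx) |>.comp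
      (tendsto_natCast_atTop_atTop (R := ℝ)))
  refine h2.congr fun n => ?_
  simp only [Function.comp, zero_add, zero_mul, zero_div, arcsin_zero, mul_zero, sub_zero, inv_inv,
    smul_eq_mul]
  congr 3
  ring

/-- A local estimate by the chordal distance on a segment implies the estimate by the length. -/
theorem dist_le_of_chord {F : ℝ → X} {K δ : ℝ}
    (h : ∀ s ∈ Icc (0 : ℝ) 1, ∀ t ∈ Icc (0 : ℝ) 1,
      dist (F s) (F t) ≤ K * (2 * arcsin (δ * |s - t| / 2))) :
    dist (F 0) (F 1) ≤ K * δ := by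
  have h1 : ∀ n : ℕ, 0 < n → dist (F 0) (F 1) ≤ K * (n * (2 * arcsin (δ / n / 2))) := by
    intro n hn
    have hn' : (0 : ℝ) < n := by exact_mod_cast hn
    have h2 := dist_le_range_sum_dist (fun i : ℕ => F (i / n)) n
    simp only [Nat.cast_zero, zero_div] at h2
    rw [div_self hn'.ne'] at h2
    refine h2.trans ?_
    have h3 : ∀ i ∈ Finset.range n, dist (F ((i : ℕ) / n)) (F ((i + 1 : ℕ) / n)) ≤
        K * (2 * arcsin (δ / n / 2)) := by
      intro i hi
      have hi' : ((i + 1 : ℕ) : ℝ) ≤ n := by exact_mod_cast Finset.mem_range.1 hi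
      have hi'' : (i : ℝ) ≤ n := le_trans (by push_cast; linarith) hi'
      have h4 := h (i / n) ⟨by positivity, (div_le_one hn').2 hi''⟩ ((i + 1 : ℕ) / n)
        ⟨by positivity, (div_le_one hn').2 hi'⟩
      have h5 : |(i : ℝ) / n - ((i + 1 : ℕ) : ℝ) / n| = 1 / n := by
        rw [← sub_div, abs_div, abs_of_pos hn']
        push_cast
        congr 1
        rw [show (i : ℝ) - (i + 1) = -1 by ring]; norm_num
      rwa [h5, mul_one_div] at h4
    refine (Finset.sum_le_sum h3).trans (le_of_eq ?_)
    rw [Finset.sum_const, Finset.card_range, nsmul_eq_mul]; ring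
  refine ge_of_tendsto ((two_mul_arcsin_tendsto δ).const_mul K) ?_
  filter_upwards [eventually_gt_atTop 0] with n hn using h1 n hn

end Subdivision

/-- A chord of length δ in the unit circle spans an arc of length 2 arcsin(δ/2), and the squared
chord of the angle arccos c is 2(1 - c). -/
theorem arccos_le_two_mul_arcsin {c δ : ℝ} (hδ : 0 ≤ δ) (h : 1 - c ≤ δ ^ 2 / 2) :
    arccos c ≤ 2 * arcsin (δ / 2) := by
  rcases le_or_gt 1 (δ / 2) with h2 | h2
  · rw [arcsin_of_one_le h2]
    linarith [arccos_le_pi c]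
  · have h0 : 0 ≤ arcsin (δ / 2) := arcsin_nonneg.2 (by positivity)
    have h1 : arcsin (δ / 2) ≤ π / 2 := arcsin_le_pi_div_two _
    rw [← arccos_cos (x := 2 * arcsin (δ / 2)) (by linarith) (by linarith)]
    refine arccos_le_arccos ?_
    rw [cos_two_mul, cos_sq', sin_arcsin (by linarith) h2.le]
    nlinarith

variable {X : Type u} [MetricSpace X] [MeasurableSpace X] [BorelSpace X]
  {γ : ℝ → X} {K : ℝ≥0}

/-- The extension of a closed Lipschitz curve to the hemisphere in spherical coordinates. -/
def hemisphereMap (b : WassersteinOne X → X) (hγ : LipschitzWith K γ) (r θ : ℝ) : X :=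
  if r < π / 2 then b (arcPoint hγ (tan r * cos θ) (tan r * sin θ)) else γ θ

theorem sqrt_one_add_tan_sq {r : ℝ} (h0 : 0 ≤ r) (h1 : r < π / 2) (θ : ℝ) :
    √(1 + (tan r * cos θ) ^ 2 + (tan r * sin θ) ^ 2) = (cos r)⁻¹ := by
  have hc : 0 < cos r := cos_pos_of_mem_Ioo ⟨by linarith [pi_pos], h1⟩
  have : 1 + (tan r * cos θ) ^ 2 + (tan r * sin θ) ^ 2 = ((cos r)⁻¹) ^ 2 := by
    rw [inv_pow, ← inv_one_add_tan_sq hc.ne', inv_inv]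
    linear_combination (tan r) ^ 2 * sin_sq_add_cos_sq θ
  rw [this, sqrt_sq (inv_pos.2 hc).le]

variable {b : WassersteinOne X → X}

theorem dist_hemisphereMap_interior (hb : IsContractingBarycenterMap b) (hγ : LipschitzWith K γ)
    (hper : Function.Periodic γ (2 * π)) {r r' : ℝ} (h0 : 0 ≤ r) (h1 : r < π / 2) (h0' : 0 ≤ r')
    (h1' : r' < π / 2) (θ θ' : ℝ) :
    dist (hemisphereMap b hγ r θ) (hemisphereMap b hγ r' θ') ≤
      K * arccos (cos r * cos r' + sin r * sin r' * cos (θ - θ')) := by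
  rw [hemisphereMap, hemisphereMap, if_pos h1, if_pos h1']
  have hc : 0 < cos r := cos_pos_of_mem_Ioo ⟨by linarith [pi_pos], h1⟩
  have hc' : 0 < cos r' := cos_pos_of_mem_Ioo ⟨by linarith [pi_pos], h1'⟩
  have h := (hb.contracting _ _).trans (wassersteinEDist_arcPoint_le hγ hper (tan r * cos θ)
    (tan r * sin θ) (tan r' * cos θ') (tan r' * sin θ'))
  rw [edist_dist, ← ENNReal.ofReal_coe_nnreal, ← ENNReal.ofReal_mul K.coe_nonneg] at h
  replace h := (ENNReal.ofReal_le_ofReal_iff (mul_nonneg K.coe_nonneg (arccos_nonneg _))).1 h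
  refine h.trans (le_of_eq ?_)
  rw [sqrt_one_add_tan_sq h0 h1, sqrt_one_add_tan_sq h0' h1', cos_sub,
    tan_eq_sin_div_cos, tan_eq_sin_div_cos]
  congr 2
  field_simp
  ring

theorem dist_hemisphereMap_boundary (hb : IsContractingBarycenterMap b) (hγ : LipschitzWith K γ)
    (hper : Function.Periodic γ (2 * π)) {r : ℝ} (h0 : 0 ≤ r) (h1 : r < π / 2) (θ θ' : ℝ) :
    dist (γ θ') (hemisphereMap b hγ r θ) ≤ K * arccos (sin r * cos (θ - θ')) := by
  rw [hemisphereMap, if_pos h1, ← hb.map_dirac (γ θ')]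
  have hc : 0 < cos r := cos_pos_of_mem_Ioo ⟨by linarith [pi_pos], h1⟩
  have h := (hb.contracting (WassersteinOne.dirac (γ θ')) _).trans
    (wassersteinEDist_dirac_arcPoint_le hγ hper (tan r * cos θ) (tan r * sin θ) θ')
  rw [edist_dist, ← ENNReal.ofReal_coe_nnreal, ← ENNReal.ofReal_mul K.coe_nonneg] at h
  replace h := (ENNReal.ofReal_le_ofReal_iff (mul_nonneg K.coe_nonneg (arccos_nonneg _))).1 h
  refine h.trans (le_of_eq ?_)
  rw [sqrt_one_add_tan_sq h0 h1, cos_sub, tan_eq_sin_div_cos]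
  congr 2
  field_simp

theorem dist_hemisphereMap_le_arccos (hb : IsContractingBarycenterMap b) (hγ : LipschitzWith K γ)
    (hper : Function.Periodic γ (2 * π)) {r r' : ℝ} (h0 : 0 ≤ r) (h1 : r ≤ π / 2) (h0' : 0 ≤ r')
    (h1' : r' ≤ π / 2) (θ θ' : ℝ) :
    dist (hemisphereMap b hγ r θ) (hemisphereMap b hγ r' θ') ≤
      K * arccos (cos r * cos r' + sin r * sin r' * cos (θ - θ')) := by
  have hγ2 : ∀ θ, hemisphereMap b hγ (π / 2) θ = γ θ := fun θ => if_neg (lt_irrefl _)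
  rcases h1.lt_or_eq with h1 | rfl <;> rcases h1'.lt_or_eq with h1' | rfl
  · exact dist_hemisphereMap_interior hb hγ hper h0 h1 h0' h1' θ θ'
  · rw [hγ2, dist_comm]
    simpa using dist_hemisphereMap_boundary hb hγ hper h0 h1 θ θ'
  · rw [hγ2, ← neg_sub θ' θ, cos_neg]
    simpa using dist_hemisphereMap_boundary hb hγ hper h0' h1' θ' θ
  · rw [hγ2, hγ2]
    -- Two boundary points are compared through an interior point above `θ'`, which is then moved to
    -- the equator; the second summand tends to zero.
    have hlim : Tendsto (fun r => K * arccos (sin r * cos (θ' - θ)) +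
        K * arccos (sin r * cos (θ' - θ'))) (𝓝[<] (π / 2))
        (𝓝 (K * arccos (sin (π / 2) * cos (θ' - θ)) +
          K * arccos (sin (π / 2) * cos (θ' - θ')))) := by
      apply tendsto_nhdsWithin_of_tendsto_nhds
      exact Continuous.tendsto (by fun_prop) _
    have h2 : dist (γ θ) (γ θ') ≤ K * arccos (sin (π / 2) * cos (θ' - θ)) +
          K * arccos (sin (π / 2) * cos (θ' - θ')) := by
      refine ge_of_tendsto hlim ?_
      have hI : Ioo 0 (π / 2) ∈ 𝓝[<] (π / 2) := Ioo_mem_nhdsLT (by positivity)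
      filter_upwards [hI] with r hr
      refine (dist_triangle_right _ _ (hemisphereMap b hγ r θ')).trans ?_
      exact add_le_add (dist_hemisphereMap_boundary hb hγ hper hr.1.le hr.2 θ' θ)
        (dist_hemisphereMap_boundary hb hγ hper hr.1.le hr.2 θ' θ')
    rw [← neg_sub θ' θ, cos_neg]
    simpa using h2

/-- On the spherical cap of radius `R`, the extension is Lipschitz with respect to the flat metric
`dr² + (sin R)² dθ²`. -/
theorem dist_hemisphereMap_le (hb : IsContractingBarycenterMap b) (hγ : LipschitzWith K γ)
    (hper : Function.Periodic γ (2 * π)) {R r r' : ℝ} (hR : R ≤ π / 2) (hr : r ∈ Icc 0 R)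
    (hr' : r' ∈ Icc 0 R) (θ θ' : ℝ) :
    dist (hemisphereMap b hγ r θ) (hemisphereMap b hγ r' θ') ≤
      K * √((r - r') ^ 2 + (sin R * (θ - θ')) ^ 2) := by
  -- The straight segment in the coordinates (r, θ). Spherical chords of its pieces are bounded by
  -- flat lengths, and subdivision removes the loss from chord to arc.
  let F : ℝ → X := fun s => hemisphereMap b hγ (r + s * (r' - r)) (θ + s * (θ' - θ))
  have hF := dist_le_of_chord (F := F) (K := K)
    (δ := √((r - r') ^ 2 + (sin R * (θ - θ')) ^ 2)) ?_
  · simpa [F] using hF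
  intro s hs t ht
  have hmem : ∀ s ∈ Icc (0 : ℝ) 1, r + s * (r' - r) ∈ Icc 0 R := by
    intro s hs
    have := (convex_Icc (0 : ℝ) R).add_smul_sub_mem hr hr' hs
    simpa using this
  have h1 := hmem s hs
  have h2 := hmem t ht
  refine (dist_hemisphereMap_le_arccos hb hγ hper h1.1 (h1.2.trans hR) h2.1 (h2.2.trans hR)
    _ _).trans ?_
  refine mul_le_mul_of_nonneg_left (arccos_le_two_mul_arcsin (by positivity) ?_) K.coe_nonneg
  rw [mul_pow, sq_sqrt (by positivity), sq_abs]
  set p := r + s * (r' - r) with hp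
  set q := r + t * (r' - r) with hq
  have e1 : θ + s * (θ' - θ) - (θ + t * (θ' - θ)) = (t - s) * (θ - θ') := by ring
  have e2 : p - q = (t - s) * (r - r') := by rw [hp, hq]; ring
  have c1 := one_sub_sq_div_two_le_cos (x := p - q)
  have c2 := one_sub_sq_div_two_le_cos (x := (t - s) * (θ - θ'))
  rw [cos_sub] at c1
  rw [e1]
  have s1 : 0 ≤ sin p := sin_nonneg_of_nonneg_of_le_pi h1.1 (by linarith [h1.2, pi_pos])
  have s2 : 0 ≤ sin q := sin_nonneg_of_nonneg_of_le_pi h2.1 (by linarith [h2.2, pi_pos])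
  have s3 : sin p ≤ sin R := sin_le_sin_of_le_of_le_pi_div_two (by linarith [h1.1, pi_pos]) hR h1.2
  have s4 : sin q ≤ sin R := sin_le_sin_of_le_of_le_pi_div_two (by linarith [h2.1, pi_pos]) hR h2.2
  have s5 : sin p * sin q ≤ sin R ^ 2 := by
    rw [sq]; exact mul_le_mul s3 s4 s2 (s1.trans s3)
  have c3 : sin p * sin q * (1 - cos ((t - s) * (θ - θ'))) ≤
      sin R ^ 2 * (((t - s) * (θ - θ')) ^ 2 / 2) :=
    mul_le_mul s5 (by linarith) (by linarith [cos_le_one ((t - s) * (θ - θ'))]) (sq_nonneg _)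
  rw [e2] at c1
  nlinarith

theorem hemisphereMap_periodic (hγ : LipschitzWith K γ) (hper : Function.Periodic γ (2 * π))
    (r : ℝ) : Function.Periodic (hemisphereMap b hγ r) (2 * π) := fun θ => by
  simp [hemisphereMap, hper θ]

end

end QuadIsop

namespace QuadIsop

universe u

noncomputable section

/-! ### Constant speed parametrization of closed curves -/

section ConstantSpeed

variable {X : Type u} [MetricSpace X]

theorem eVariationOn_Icc_le {c : ℝ → X} {C : ℝ≥0} (hc : LipschitzWith C c) {a b : ℝ}
    (hab : a ≤ b) : eVariationOn c (Icc a b) ≤ C * ENNReal.ofReal (b - a) := by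
  refine ((hc.lipschitzOnWith (s := univ)).comp_eVariationOn_le (g := id) (s := Icc a b)
    (mapsTo_univ _ _)).trans ?_
  gcongr
  have h := (monotoneOn_id (s := Icc a b)).eVariationOn_eq (left_mem_Icc.2 hab)
    (right_mem_Icc.2 hab)
  rw [inter_self] at h
  exact h.le

theorem dist_le_variationOnFromTo {c : ℝ → X} (hc : LocallyBoundedVariationOn c univ) {a b : ℝ}
    (hab : a ≤ b) : dist (c a) (c b) ≤ variationOnFromTo c univ a b := by
  rw [variationOnFromTo.eq_of_le _ _ hab, dist_edist]
  exact ENNReal.toReal_mono (hc a b trivial trivial)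
    (eVariationOn.edist_le c ⟨trivial, left_mem_Icc.2 hab⟩ ⟨trivial, right_mem_Icc.2 hab⟩)

/-- A closed Lipschitz curve is a Lipschitz reparametrization of a closed curve whose Lipschitz
constant is the length divided by the period. -/
theorem exists_constantSpeed {c : ℝ → X} {C : ℝ≥0} (hc : LipschitzWith C c) {T : ℝ} (hT : 0 < T)
    (hper : Function.Periodic c T) :
    ∃ (γ : ℝ → X) (σ : ℝ → ℝ) (C' : ℝ≥0),
      LipschitzWith (Real.toNNReal ((eVariationOn c (Icc 0 T)).toReal / T)) γ ∧
      Function.Periodic γ T ∧ LipschitzWith C' σ ∧ (∀ t, σ (t + T) = σ t + T) ∧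
      ∀ t, γ (σ t) = c t := by
  have hbv : LocallyBoundedVariationOn c univ := hc.locallyBoundedVariationOn univ
  set V := (eVariationOn c (Icc 0 T)).toReal with hV
  let v : ℝ → ℝ := variationOnFromTo c univ 0
  have hv : ∀ a b, v b - v a = variationOnFromTo c univ a b := fun a b =>
    variationOnFromTo.sub_right hbv trivial trivial trivial
  have hvd : ∀ a b, dist (c a) (c b) ≤ |v a - v b| := by
    intro a b
    rcases le_total a b with h | h
    · rw [abs_sub_comm, hv, abs_of_nonneg (variationOnFromTo.nonneg_of_le _ _ h)]
      exact dist_le_variationOnFromTo hbv h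
    · rw [hv, abs_of_nonneg (variationOnFromTo.nonneg_of_le _ _ h), dist_comm]
      exact dist_le_variationOnFromTo hbv h
  have hvT : ∀ t, v (t + T) = v t + V := by
    intro t
    have h1 : variationOnFromTo c univ T (t + T) = v t := by
      have h2 := variationOnFromTo.comp_eq_of_monotoneOn c (fun x => x + T) (t := univ)
        (fun x _ y _ h => by simpa using h) (mem_univ 0) (mem_univ t)
      have h3 : (c ∘ fun x => x + T) = c := funext hper
      rw [h3, image_univ, (add_right_surjective T).range_eq, zero_add] at h2
      exact h2.symm
    have h4 : v T = V := by
      rw [hV]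
      change variationOnFromTo c univ 0 T = _
      rw [variationOnFromTo.eq_of_le _ _ hT.le, univ_inter]
    have h5 := hv T (t + T)
    rw [h1, h4] at h5
    linarith
  have hvl : ∀ a b, |v a - v b| ≤ C * |a - b| := by
    have key : ∀ a b, a ≤ b → |v a - v b| ≤ C * |a - b| := by
      intro a b h
      rw [abs_sub_comm, hv, abs_of_nonneg (variationOnFromTo.nonneg_of_le _ _ h),
        variationOnFromTo.eq_of_le _ _ h, univ_inter, abs_sub_comm a b,
        abs_of_nonneg (sub_nonneg.2 h)]
      refine ENNReal.toReal_le_of_le_ofReal (mul_nonneg C.coe_nonneg (sub_nonneg.2 h)) ?_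
      rw [ENNReal.ofReal_mul C.coe_nonneg, ENNReal.ofReal_coe_nnreal]
      exact eVariationOn_Icc_le hc h
    intro a b
    rcases le_total a b with h | h
    · exact key a b h
    · rw [abs_sub_comm, abs_sub_comm a b]; exact key b a h
  have hV0 : 0 ≤ V := ENNReal.toReal_nonneg
  rcases hV0.eq_or_lt with hV0 | hV0
  · have hvp : Function.Periodic v T := fun t => by rw [hvT, ← hV0, add_zero]
    -- A monotone periodic function is constant; hence the curve itself is constant and needs no
    -- reparametrization.
    have hv0 : ∀ t, v t = 0 := by
      have h0 : v 0 = 0 := variationOnFromTo.self _ _ _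
      have hmono : Monotone v := fun a b h => by
        have := variationOnFromTo.nonneg_of_le c univ h
        rw [← hv] at this; linarith
      intro t
      obtain ⟨n, hn⟩ := exists_nat_ge (|t| / T)
      rw [div_le_iff₀ hT] at hn
      have h1 := hmono ((abs_le.1 hn).2)
      have h2 := hmono ((abs_le.1 hn).1)
      have h3 := hvp.nat_mul n 0
      have h4 := hvp.neg.nat_mul n 0
      simp only [zero_add] at h3 h4
      rw [h3, h0] at h1
      rw [← mul_neg, h4, h0] at h2
      exact le_antisymm h1 h2
    refine ⟨c, id, 1, ?_, hper, LipschitzWith.id, fun t => rfl, fun t => rfl⟩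
    refine LipschitzWith.of_dist_le_mul fun a b => ?_
    have := hvd a b
    rw [hv0, hv0, sub_zero, abs_zero] at this
    exact this.trans (by positivity)
  -- Arc length rescaled so that one period of the curve has length T.
  · let σ : ℝ → ℝ := fun t => T / V * v t
    have hσT : ∀ t, σ (t + T) = σ t + T := by
      intro t
      simp only [σ, hvT]
      field_simp
    have hσl : LipschitzWith (Real.toNNReal (T / V * C)) σ := by
      refine LipschitzWith.of_dist_le_mul fun a b => ?_
      rw [Real.coe_toNNReal _ (by positivity), Real.dist_eq, Real.dist_eq]
      simp only [σ]
      rw [← mul_sub, abs_mul, abs_of_pos (div_pos hT hV0), mul_assoc]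
      exact mul_le_mul_of_nonneg_left (hvl a b) (by positivity)
    have hsurj : Function.Surjective σ := by
      have h0 : σ 0 = 0 := by
        simp only [σ, v, variationOnFromTo.self, mul_zero]
      have hp : Function.Periodic (fun t => σ t - t) T := fun t => by
        simp only [hσT]; ring
      intro w
      obtain ⟨n, hn⟩ := exists_nat_ge (|w| / T)
      rw [div_le_iff₀ hT] at hn
      have h3 := hp.nat_mul n 0
      have h4 := hp.neg.nat_mul n 0
      simp only [zero_add, h0, sub_zero] at h3 h4
      rw [mul_neg] at h4
      have hle : -(n * T) ≤ n * T := by have := abs_nonneg w; linarith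
      have hw : w ∈ Icc (σ (-(n * T))) (σ (n * T)) :=
        ⟨by linarith [(abs_le.1 hn).1], by linarith [(abs_le.1 hn).2]⟩
      obtain ⟨t, -, ht⟩ := intermediate_value_Icc hle hσl.continuous.continuousOn hw
      exact ⟨t, ht⟩
    -- Any section will do, because the curve is constant on the fibres of `σ`.
    let τ := Function.surjInv hsurj
    have hτ : ∀ w, σ (τ w) = w := Function.surjInv_eq hsurj
    have hlip : ∀ a b, dist (c a) (c b) ≤ V / T * |σ a - σ b| := by
      intro a b
      simp only [σ]
      rw [← mul_sub, abs_mul, abs_of_pos (div_pos hT hV0), ← mul_assoc,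
        div_mul_div_cancel₀ hT.ne', div_self hV0.ne', one_mul]
      exact hvd a b
    have hγσ : ∀ t, c (τ (σ t)) = c t := by
      intro t
      have := hlip (τ (σ t)) t
      rw [hτ, sub_self, abs_zero, mul_zero] at this
      exact dist_le_zero.1 this
    refine ⟨fun w => c (τ w), σ, _, ?_, ?_, hσl, hσT, hγσ⟩
    · refine LipschitzWith.of_dist_le_mul fun a b => ?_
      rw [Real.coe_toNNReal _ (by positivity), Real.dist_eq]
      have := hlip (τ a) (τ b)
      rwa [hτ, hτ] at this
    · intro w
      obtain ⟨t, rfl⟩ := hsurj w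
      simp only [← hσT, hγσ, hper t]

end ConstantSpeed

theorem circleParam_periodic : Function.Periodic circleParam (2 * Real.pi) := fun t => by
  simp [circleParam]

theorem lipschitzWith_circleParam : LipschitzWith 2 circleParam := by
  refine LipschitzWith.of_dist_le_mul fun a b => ?_
  rw [Subtype.dist_eq, EuclideanSpace.dist_eq]
  simp only [circleParam, Fin.sum_univ_two, Real.dist_eq]
  apply Real.sqrt_le_iff.2 ⟨by positivity, ?_⟩
  have h1 := Real.abs_cos_sub_cos_le a b
  have h2 := Real.abs_sin_sub_sin_le a b
  have h3 := mul_self_le_mul_self (abs_nonneg _) h1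
  have h4 := mul_self_le_mul_self (abs_nonneg _) h2
  simp
  nlinarith [abs_mul_abs_self (Real.cos a - Real.cos b), abs_mul_abs_self (Real.sin a - Real.sin b),
    abs_mul_abs_self (a - b)]

end

end QuadIsop

namespace QuadIsop

universe u

noncomputable section

/-! ### Area functionals and maps factoring through the plane -/

section AreaLemmas

/-- The Euclidean plane in an arbitrary universe. -/
def LiftedPlane : Type u := ULift.{u} Plane

instance : MetricSpace LiftedPlane.{u} := inferInstanceAs (MetricSpace (ULift.{u} Plane))

instance : MeasurableSpace LiftedPlane.{u} := borel _

instance : BorelSpace LiftedPlane.{u} := ⟨rfl⟩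

/-- The isometry from the lifted plane to the plane. -/
def LiftedPlane.isometryEquiv : LiftedPlane.{u} ≃ᵢ Plane :=
  ⟨Equiv.ulift, fun _ _ => rfl⟩

theorem isRiemannianSpace_liftedPlane : IsRiemannianSpace LiftedPlane.{u} :=
  ⟨2, Plane, inferInstance, inferInstance, inferInstance, inferInstance, inferInstance,
    inferInstance, ⟨LiftedPlane.isometryEquiv⟩⟩

theorem hausdorffMeasure_liftedPlane (R : Set Plane) :
    (μHE[2] : Measure LiftedPlane.{u}) (LiftedPlane.isometryEquiv.{u}.symm '' R) = volume R := by
  rw [LiftedPlane.isometryEquiv.symm.isometry.euclideanHausdorffMeasure_image,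
    EuclideanSpace.euclideanHausdorffMeasure_eq_volume]

variable {X : Type u} [MetricSpace X] (A : AreaFunctional.{u}) {E : Set Plane}

theorem busemannArea_le_of_injective {T : E → LiftedPlane.{u}} (hT : Function.Injective T)
    {R : Set Plane} (hR : ∀ x, LiftedPlane.isometryEquiv (T x) ∈ R) :
    busemannArea T ≤ volume R := by
  rw [← hausdorffMeasure_liftedPlane.{u}, busemannArea]
  refine le_trans (lintegral_mono (g := (LiftedPlane.isometryEquiv.{u}.symm '' R).indicator 1)
    fun y => ?_) (lintegral_indicator_one_le _)
  by_cases hy : ∃ x, T x = y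
  · obtain ⟨x, rfl⟩ := hy
    have hm : T x ∈ LiftedPlane.isometryEquiv.{u}.symm '' R :=
      ⟨_, hR x, LiftedPlane.isometryEquiv.symm_apply_apply _⟩
    rw [indicator_of_mem hm]
    have : T ⁻¹' {T x} = {x} := by
      ext z; simp [hT.eq_iff]
    rw [this]; simp
  · have : T ⁻¹' {y} = ∅ := by
      ext z; simp only [mem_preimage, mem_singleton_iff, mem_empty_iff_false, iff_false]
      exact fun h => hy ⟨z, h⟩
    rw [this]; simp

theorem busemannArea_eq_zero {T : E → LiftedPlane.{u}}
    {R : Set Plane} (hR : ∀ x, LiftedPlane.isometryEquiv (T x) ∈ R) (h0 : volume R = 0) :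
    busemannArea T = 0 := by
  rw [busemannArea, lintegral_eq_zero_of_ae_eq_zero]
  have : ∀ᵐ y ∂(μHE[2] : Measure LiftedPlane.{u}),
      y ∉ LiftedPlane.isometryEquiv.{u}.symm '' R := by
    rw [← hausdorffMeasure_liftedPlane.{u}] at h0
    exact measure_eq_zero_iff_ae_notMem.1 h0
  filter_upwards [this] with y hy
  have : T ⁻¹' {y} = ∅ := by
    ext z; simp only [mem_preimage, mem_singleton_iff, mem_empty_iff_false, iff_false]
    rintro rfl
    exact hy ⟨_, hR z, LiftedPlane.isometryEquiv.symm_apply_apply _⟩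
  rw [this]; simp

/-- A map factoring as a Lipschitz map of the plane after an injective map `T` has area at most the
squared Lipschitz constant times the area of the image of `T`. -/
theorem AreaFunctional.area_le_of_factor (hE : MeasurableSet E) {f : E → X} {T : E → Plane}
    (hT : IsLipschitz T) (hTi : Function.Injective T) {g : Plane → X} {K : ℝ≥0}
    (hg : LipschitzWith K g) (hf : ∀ x, f x = g (T x)) {R : Set Plane} (hR : ∀ x, T x ∈ R) :
    A.area f ≤ (K : ℝ≥0∞) ^ 2 * volume R := by
  let T' : E → LiftedPlane.{u} := fun x => LiftedPlane.isometryEquiv.symm (T x)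
  have hT' : IsLipschitz T' := by
    obtain ⟨C, hC⟩ := hT
    exact ⟨1 * C, LiftedPlane.isometryEquiv.symm.isometry.lipschitz.comp hC⟩
  have hg' : LipschitzWith K (g ∘ LiftedPlane.isometryEquiv.{u}) := by
    simpa using hg.comp LiftedPlane.isometryEquiv.{u}.isometry.lipschitz
  have hf' : f = (g ∘ LiftedPlane.isometryEquiv.{u}) ∘ T' := by
    funext x; simp [T', hf]
  rw [hf']
  refine (A.monotonicity T' _ K hE hT' hg').trans ?_
  rw [A.normalization T' hE hT' isRiemannianSpace_liftedPlane]
  gcongr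
  exact busemannArea_le_of_injective (LiftedPlane.isometryEquiv.symm.injective.comp hTi)
    fun x => by simpa [T'] using hR x

/-- A map factoring through a null set of the plane has area zero. -/
theorem AreaFunctional.area_eq_zero_of_factor (hE : MeasurableSet E) {f : E → X} {T : E → Plane}
    (hT : IsLipschitz T) {g : Plane → X} {K : ℝ≥0}
    (hg : LipschitzWith K g) (hf : ∀ x, f x = g (T x)) {R : Set Plane} (hR : ∀ x, T x ∈ R)
    (h0 : volume R = 0) : A.area f = 0 := by
  let T' : E → LiftedPlane.{u} := fun x => LiftedPlane.isometryEquiv.symm (T x)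
  have hT' : IsLipschitz T' := by
    obtain ⟨C, hC⟩ := hT
    exact ⟨1 * C, LiftedPlane.isometryEquiv.symm.isometry.lipschitz.comp hC⟩
  have hg' : LipschitzWith K (g ∘ LiftedPlane.isometryEquiv.{u}) := by
    simpa using hg.comp LiftedPlane.isometryEquiv.{u}.isometry.lipschitz
  have hf' : f = (g ∘ LiftedPlane.isometryEquiv.{u}) ∘ T' := by
    funext x; simp [T', hf]
  rw [hf']
  refine le_antisymm ((A.monotonicity T' _ K hE hT' hg').trans ?_) zero_le
  rw [A.normalization T' hE hT' isRiemannianSpace_liftedPlane,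
    busemannArea_eq_zero (R := R) (fun x => by simpa [T'] using hR x) h0, mul_zero]

theorem AreaFunctional.area_eq_tsum {ι : Type*} [Countable ι] [Infinite ι] (f : E → X) (S : ι → Set Plane)
    (hSE : ∀ i, S i ⊆ E) (hE : MeasurableSet E) (hS : ∀ i, MeasurableSet (S i))
    (hES : E ⊆ ⋃ i, S i) (hd : Pairwise (Function.onFun Disjoint S)) (hf : IsLipschitz f) :
    A.area f = ∑' i, A.area (f ∘ Set.inclusion (hSE i)) := by
  obtain ⟨_⟩ := nonempty_denumerable ι
  let e := (Denumerable.eqv ι).symm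
  rw [A.sigma_additivity f (S ∘ e) (fun i => hSE (e i)) hE (fun i => hS (e i))
    (fun x hx => by
      obtain ⟨i, hi⟩ := mem_iUnion.1 (hES hx)
      exact mem_iUnion.2 ⟨e.symm i, by simpa using hi⟩)
    (fun i j hij => hd (e.injective.ne hij)) hf]
  exact e.tsum_eq fun i => A.area (f ∘ Set.inclusion (hSE i))

end AreaLemmas

/-! ### Polar coordinates -/

section Polar

open Real

/-- The polar angle in `(-π, π]`. -/
def polarAngle (x : Plane) : ℝ := Complex.arg ⟨x 0, x 1⟩

theorem norm_mk_eq (x : Plane) : ‖(⟨x 0, x 1⟩ : ℂ)‖ = ‖x‖ := by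
  rw [Complex.norm_eq_sqrt_sq_add_sq, EuclideanSpace.norm_eq]
  simp [Fin.sum_univ_two]

theorem norm_mul_cos_polarAngle (x : Plane) : ‖x‖ * cos (polarAngle x) = x 0 := by
  rw [← norm_mk_eq]; exact Complex.norm_mul_cos_arg _

theorem norm_mul_sin_polarAngle (x : Plane) : ‖x‖ * sin (polarAngle x) = x 1 := by
  rw [← norm_mk_eq]; exact Complex.norm_mul_sin_arg _

theorem abs_polarAngle_le (x : Plane) : |polarAngle x| ≤ π := Complex.abs_arg_le_pi _

theorem dist_sq_polar (x y : Plane) : dist x y ^ 2 =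
    (‖x‖ - ‖y‖) ^ 2 + 2 * ‖x‖ * ‖y‖ * (1 - cos (polarAngle x - polarAngle y)) := by
  rw [EuclideanSpace.dist_eq, sq_sqrt (by positivity)]
  simp only [Fin.sum_univ_two, Real.dist_eq, sq_abs]
  rw [← norm_mul_cos_polarAngle x, ← norm_mul_cos_polarAngle y, ← norm_mul_sin_polarAngle x,
    ← norm_mul_sin_polarAngle y, cos_sub]
  linear_combination ‖x‖ ^ 2 * sin_sq_add_cos_sq (polarAngle x) +
    ‖y‖ ^ 2 * sin_sq_add_cos_sq (polarAngle y)

theorem abs_norm_sub_le_dist (x y : Plane) : |‖x‖ - ‖y‖| ≤ dist x y := by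
  rw [dist_eq_norm]; exact abs_norm_sub_norm_le x y

/-- This rests on 1 - cos δ ≥ 2δ²/π² for |δ| ≤ π. Only the cosine of the angle matters, so δ may be
any representative of the angle difference modulo 2π. -/
theorem angle_le_of_cos {x y : Plane} {r δ : ℝ} (hr : 0 ≤ r) (hx : r ≤ ‖x‖) (hy : r ≤ ‖y‖)
    (hδ : |δ| ≤ π) (hcos : cos (polarAngle x - polarAngle y) = cos δ) :
    r * |δ| ≤ π / 2 * dist x y := by
  have h1 := cos_le_one_sub_mul_cos_sq hδ
  have h2 := dist_sq_polar x y
  rw [hcos] at h2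
  have h3 : r * r ≤ ‖x‖ * ‖y‖ := mul_le_mul hx hy hr (hr.trans hx)
  have h4 : 0 ≤ 2 / π ^ 2 * δ ^ 2 := by positivity
  have h5 : 2 * (r * r) * (2 / π ^ 2 * δ ^ 2) ≤ dist x y ^ 2 := by
    rw [h2]
    have h6 : 2 * (r * r) * (2 / π ^ 2 * δ ^ 2) ≤ 2 * (‖x‖ * ‖y‖) * (1 - cos δ) :=
      mul_le_mul (by linarith) (by linarith) h4 (by positivity)
    nlinarith [sq_nonneg (‖x‖ - ‖y‖)]
  refine (sq_le_sq₀ (by positivity) (by positivity)).1 ?_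
  have h7 : (r * |δ|) ^ 2 = (π / 2) ^ 2 * (2 * (r * r) * (2 / π ^ 2 * δ ^ 2)) := by
    rw [mul_pow, sq_abs]
    field_simp
  rw [h7, mul_pow]
  gcongr

/-- The polar angle is Lipschitz on half planes away from the origin. -/
theorem abs_polarAngle_sub_le {x y : Plane} {r : ℝ} (hr : 0 ≤ r) (hx : r ≤ ‖x‖) (hy : r ≤ ‖y‖)
    (h : |polarAngle x - polarAngle y| ≤ π) :
    r * |polarAngle x - polarAngle y| ≤ π / 2 * dist x y :=
  angle_le_of_cos hr hx hy h rfl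

/-- A map given in polar coordinates is Lipschitz if it is Lipschitz in the radius and, with
constant proportional to the radius, in the angle. -/
theorem lipschitzWith_polar {X : Type u} [MetricSpace X] {F : ℝ → ℝ → X} {C : ℝ≥0}
    (hper : ∀ r, Function.Periodic (F r) (2 * π))
    (h1 : ∀ r r' θ, 0 ≤ r → 0 ≤ r' → |θ| ≤ π → dist (F r θ) (F r' θ) ≤ C * |r - r'|)
    (h2 : ∀ r θ θ', 0 ≤ r → dist (F r θ) (F r θ') ≤ C * (r * |θ - θ'|)) :
    LipschitzWith (C * (2 + 1)) fun x : Plane => F ‖x‖ (polarAngle x) := by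
  have key : ∀ x y : Plane, ‖x‖ ≤ ‖y‖ →
      dist (F ‖x‖ (polarAngle x)) (F ‖y‖ (polarAngle y)) ≤ C * (2 + 1) * dist x y := by
    intro x y hxy
    -- Across the branch cut the angle of x is shifted by 2π to come within π of the angle of y;
    -- periodicity of `F` makes this harmless.
    obtain ⟨θ, hθ, hcos, hF⟩ : ∃ θ, |θ - polarAngle y| ≤ π ∧
        cos (polarAngle x - polarAngle y) = cos (θ - polarAngle y) ∧
        F ‖x‖ (polarAngle x) = F ‖x‖ θ := by
      have h3 := abs_le.1 (abs_polarAngle_le x)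
      have h4 := abs_le.1 (abs_polarAngle_le y)
      by_cases ha : polarAngle x - polarAngle y ≤ π
      · by_cases hb : -π ≤ polarAngle x - polarAngle y
        · exact ⟨polarAngle x, abs_le.2 ⟨hb, ha⟩, rfl, rfl⟩
        · refine ⟨polarAngle x + 2 * π, abs_le.2 ⟨by linarith, by linarith⟩, ?_,
            (hper _ _).symm⟩
          rw [add_sub_right_comm, cos_add_two_pi]
      · refine ⟨polarAngle x - 2 * π, abs_le.2 ⟨by linarith, by linarith⟩, ?_,
          ((hper _).sub_eq _).symm⟩
        rw [sub_right_comm, cos_sub_two_pi]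
    have h5 := angle_le_of_cos (norm_nonneg x) le_rfl hxy hθ hcos
    have h6 : π / 2 * dist x y ≤ 2 * dist x y := by
      have := pi_le_four
      have := dist_nonneg (x := x) (y := y)
      nlinarith
    rw [hF]
    calc dist (F ‖x‖ θ) (F ‖y‖ (polarAngle y))
        ≤ dist (F ‖x‖ θ) (F ‖x‖ (polarAngle y)) +
          dist (F ‖x‖ (polarAngle y)) (F ‖y‖ (polarAngle y)) := dist_triangle _ _ _
      _ ≤ C * (‖x‖ * |θ - polarAngle y|) + C * |‖x‖ - ‖y‖| :=
        add_le_add (h2 _ _ _ (norm_nonneg x))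
          (h1 _ _ _ (norm_nonneg x) (norm_nonneg y) (abs_polarAngle_le y))
      _ ≤ C * (2 * dist x y) + C * dist x y :=
        add_le_add (mul_le_mul_of_nonneg_left (h5.trans h6) C.coe_nonneg)
          (mul_le_mul_of_nonneg_left (abs_norm_sub_le_dist x y) C.coe_nonneg)
      _ = _ := by ring
  refine LipschitzWith.of_dist_le_mul fun x y => ?_
  push_cast
  rcases le_total ‖x‖ ‖y‖ with h | h
  · exact key x y h
  · rw [dist_comm, dist_comm x]; exact key y x h

theorem dist_plane_le (x y : Plane) : dist x y ≤ |x 0 - y 0| + |x 1 - y 1| := by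
  rw [EuclideanSpace.dist_eq, Fin.sum_univ_two, Real.dist_eq, Real.dist_eq]
  refine Real.sqrt_le_iff.2 ⟨by positivity, ?_⟩
  nlinarith [abs_nonneg (x 0 - y 0), abs_nonneg (x 1 - y 1)]

theorem dist_plane_eq (x y : Plane) : dist x y = √((x 0 - y 0) ^ 2 + (x 1 - y 1) ^ 2) := by
  rw [EuclideanSpace.dist_eq, Fin.sum_univ_two, Real.dist_eq, Real.dist_eq, sq_abs, sq_abs]

/-- A coordinate rectangle of the plane. -/
def rectangle (a b c d : ℝ) : Set Plane := {x | x 0 ∈ Icc a b ∧ x 1 ∈ Icc c d}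

theorem volume_rectangle (a b c d : ℝ) :
    volume (rectangle a b c d) = ENNReal.ofReal (b - a) * ENNReal.ofReal (d - c) := by
  have h := (EuclideanSpace.volume_preserving_symm_measurableEquiv_toLp (Fin 2)).measure_preimage
    (s := univ.pi ![Icc a b, Icc c d]) (MeasurableSet.univ_pi fun i => by
      fin_cases i <;> exact measurableSet_Icc).nullMeasurableSet
  rw [volume_pi_pi, Fin.prod_univ_two] at h
  simp only [Matrix.cons_val_zero, Matrix.cons_val_one, Real.volume_Icc] at h
  rw [← h]
  congr 1
  ext x
  simp [rectangle, Set.mem_pi, Fin.forall_fin_two]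

theorem plane_ext {x y : Plane} (hr : ‖x‖ = ‖y‖) (ha : polarAngle x = polarAngle y) : x = y := by
  ext i
  fin_cases i
  · change x 0 = y 0
    rw [← norm_mul_cos_polarAngle x, ← norm_mul_cos_polarAngle y, hr, ha]
  · change x 1 = y 1
    rw [← norm_mul_sin_polarAngle x, ← norm_mul_sin_polarAngle y, hr, ha]

theorem circleParam_polarAngle (p : circle) : circleParam (polarAngle p.1) = p := by
  have hp : ‖p.1‖ = 1 := by simp
  have h1 := norm_mul_cos_polarAngle p.1
  have h2 := norm_mul_sin_polarAngle p.1
  rw [hp, one_mul] at h1 h2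
  apply Subtype.ext
  ext i
  fin_cases i
  · exact h1
  · exact h2

end Polar

end

end QuadIsop

namespace QuadIsop

universe u

noncomputable section

/-! ### The filling -/

section Filling

open Real Filter Topology

variable {X : Type u} [MetricSpace X]

/-- A hemisphere with boundary `γ`, extended by a homotopy in the image of `γ` from `γ` to `γ ∘ σ`,
in polar coordinates. -/
def polarFilling (Ψ : ℝ → ℝ → X) (γ : ℝ → X) (σ : ℝ → ℝ) (r θ : ℝ) : X :=
  if r ≤ 1 / 2 then Ψ (π * r) θ
  else γ ((2 - 2 * min r 1) * θ + (2 * min r 1 - 1) * σ θ)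

/-- The data from which the filling is built: an extension `Ψ` of the closed curve `γ` to the
hemisphere in spherical coordinates, and a reparametrization `σ`. -/
structure HemisphereData (K : ℝ≥0) (Ψ : ℝ → ℝ → X) (γ : ℝ → X) (σ : ℝ → ℝ) (C : ℝ≥0) : Prop where
  dist_le : ∀ {R r r' : ℝ}, R ≤ π / 2 → r ∈ Icc 0 R → r' ∈ Icc 0 R → ∀ θ θ' : ℝ,
    dist (Ψ r θ) (Ψ r' θ') ≤ K * √((r - r') ^ 2 + (sin R * (θ - θ')) ^ 2)
  boundary : ∀ θ, Ψ (π / 2) θ = γ θ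
  periodic : ∀ r, Function.Periodic (Ψ r) (2 * π)
  lipschitz_curve : LipschitzWith K γ
  periodic_curve : Function.Periodic γ (2 * π)
  lipschitz_param : LipschitzWith C σ
  param_add : ∀ t, σ (t + 2 * π) = σ t + 2 * π

namespace HemisphereData

variable {K C : ℝ≥0} {Ψ : ℝ → ℝ → X} {γ : ℝ → X} {σ : ℝ → ℝ}

theorem polarFilling_of_ge (h : HemisphereData K Ψ γ σ C) {r : ℝ} (hr : 1 / 2 ≤ r) (θ : ℝ) :
    polarFilling Ψ γ σ r θ = γ ((2 - 2 * min r 1) * θ + (2 * min r 1 - 1) * σ θ) := by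
  rcases hr.eq_or_lt with rfl | hr
  · rw [polarFilling, if_pos le_rfl, mul_one_div, h.boundary, min_eq_left (by norm_num)]
    congr 1; ring
  · rw [polarFilling, if_neg (not_le.2 hr)]

theorem polarFilling_periodic (h : HemisphereData K Ψ γ σ C) (r : ℝ) :
    Function.Periodic (polarFilling Ψ γ σ r) (2 * π) := by
  intro θ
  unfold polarFilling
  split_ifs
  · exact h.periodic _ _
  · rw [h.param_add, show (2 - 2 * min r 1) * (θ + 2 * π) + (2 * min r 1 - 1) * (σ θ + 2 * π) =
      (2 - 2 * min r 1) * θ + (2 * min r 1 - 1) * σ θ + 2 * π by ring, h.periodic_curve]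

/-- A Lipschitz constant for the filling. -/
def lipConst (K C : ℝ≥0) (σ : ℝ → ℝ) : ℝ≥0 := K * (4 + 2 * (‖σ 0‖₊ + (C + 1) * 4) + 2 * (1 + C))

theorem abs_param_sub_le (h : HemisphereData K Ψ γ σ C) {θ : ℝ} (hθ : |θ| ≤ π) :
    |σ θ - θ| ≤ |σ 0| + (C + 1) * 4 := by
  have h1 := h.lipschitz_param.dist_le_mul θ 0
  rw [Real.dist_eq, Real.dist_eq, sub_zero] at h1
  have h2 : |σ θ - θ| ≤ |σ 0| + (|σ θ - σ 0| + |θ|) := by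
    rw [show σ θ - θ = σ 0 + ((σ θ - σ 0) - θ) by ring]
    exact (abs_add_le _ _).trans (add_le_add_right (abs_sub _ _) _)
  have h3 := hθ.trans pi_le_four
  have := C.coe_nonneg
  nlinarith

theorem dist_radial_le (h : HemisphereData K Ψ γ σ C) {r r' θ : ℝ} (hr : 0 ≤ r) (hr' : 0 ≤ r')
    (hθ : |θ| ≤ π) :
    dist (polarFilling Ψ γ σ r θ) (polarFilling Ψ γ σ r' θ) ≤ lipConst K C σ * |r - r'| := by
  have hK := K.coe_nonneg
  have hC := C.coe_nonneg
  have hσ := abs_nonneg (σ 0)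
  have hc : (lipConst K C σ : ℝ) = K * (4 + 2 * (|σ 0| + (C + 1) * 4) + 2 * (1 + C)) := by
    simp [lipConst]
  have inner : ∀ {r r' : ℝ}, 0 ≤ r → 0 ≤ r' → r ≤ 1 / 2 → r' ≤ 1 / 2 →
      dist (polarFilling Ψ γ σ r θ) (polarFilling Ψ γ σ r' θ) ≤ lipConst K C σ * |r - r'| := by
    intro r r' h0 h0' h1 h1'
    rw [polarFilling, polarFilling, if_pos h1, if_pos h1']
    refine (h.dist_le le_rfl ⟨by positivity, by nlinarith [pi_pos]⟩
      ⟨by positivity, by nlinarith [pi_pos]⟩ θ θ).trans ?_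
    rw [sub_self, mul_zero, zero_pow two_ne_zero, add_zero, sqrt_sq_eq_abs, ← mul_sub, abs_mul,
      abs_of_pos pi_pos, hc, mul_assoc]
    refine mul_le_mul_of_nonneg_left (mul_le_mul_of_nonneg_right ?_ (abs_nonneg _)) hK
    nlinarith [pi_le_four]
  have outer : ∀ {r r' : ℝ}, 1 / 2 ≤ r → 1 / 2 ≤ r' →
      dist (polarFilling Ψ γ σ r θ) (polarFilling Ψ γ σ r' θ) ≤ lipConst K C σ * |r - r'| := by
    intro r r' h1 h1'
    rw [h.polarFilling_of_ge h1, h.polarFilling_of_ge h1']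
    refine (h.lipschitz_curve.dist_le_mul _ _).trans ?_
    rw [Real.dist_eq, hc, mul_assoc]
    refine mul_le_mul_of_nonneg_left ?_ hK
    rw [show (2 - 2 * min r 1) * θ + (2 * min r 1 - 1) * σ θ -
      ((2 - 2 * min r' 1) * θ + (2 * min r' 1 - 1) * σ θ) =
      (min r 1 - min r' 1) * (2 * (σ θ - θ)) by ring, abs_mul, abs_mul, mul_comm]
    refine mul_le_mul ?_ ?_ (abs_nonneg _) (by positivity)
    · have := h.abs_param_sub_le hθ
      rw [abs_of_pos (by norm_num : (0 : ℝ) < 2)]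
      nlinarith
    · simpa using abs_min_sub_min_le_max r 1 r' 1
  rcases le_total r (1 / 2) with h1 | h1 <;> rcases le_total r' (1 / 2) with h1' | h1'
  · exact inner hr hr' h1 h1'
  · refine (dist_triangle _ (polarFilling Ψ γ σ (1 / 2) θ) _).trans
      ((add_le_add (inner hr (by norm_num) h1 le_rfl) (outer le_rfl h1')).trans (le_of_eq ?_))
    rw [abs_of_nonpos (by linarith), abs_of_nonpos (by linarith), abs_of_nonpos (by linarith)]
    ring
  · refine (dist_triangle _ (polarFilling Ψ γ σ (1 / 2) θ) _).trans
      ((add_le_add (outer h1 le_rfl) (inner (by norm_num) hr' le_rfl h1')).trans (le_of_eq ?_))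
    rw [abs_of_nonneg (by linarith), abs_of_nonneg (by linarith), abs_of_nonneg (by linarith)]
    ring
  · exact outer h1 h1'

theorem dist_angular_le (h : HemisphereData K Ψ γ σ C) {r θ θ' : ℝ} (hr : 0 ≤ r) :
    dist (polarFilling Ψ γ σ r θ) (polarFilling Ψ γ σ r θ') ≤
      lipConst K C σ * (r * |θ - θ'|) := by
  have hK := K.coe_nonneg
  have hC := C.coe_nonneg
  have hσ := abs_nonneg (σ 0)
  have hc : (lipConst K C σ : ℝ) = K * (4 + 2 * (|σ 0| + (C + 1) * 4) + 2 * (1 + C)) := by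
    simp [lipConst]
  have hΔ := abs_nonneg (θ - θ')
  rcases le_total r (1 / 2) with h1 | h1
  · rw [polarFilling, polarFilling, if_pos h1, if_pos h1]
    have hπr : 0 ≤ π * r := by positivity
    have hs : 0 ≤ sin (π * r) := sin_nonneg_of_nonneg_of_le_pi hπr (by nlinarith [pi_pos])
    refine (h.dist_le (R := π * r) (by nlinarith [pi_pos]) ⟨hπr, le_rfl⟩
      ⟨hπr, le_rfl⟩ θ θ').trans ?_
    rw [sub_self, zero_pow two_ne_zero, zero_add, sqrt_sq_eq_abs, abs_mul, abs_of_nonneg hs, hc,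
      mul_assoc, ← mul_assoc _ r]
    refine mul_le_mul_of_nonneg_left (mul_le_mul_of_nonneg_right ?_ hΔ) hK
    refine (sin_le hπr).trans (mul_le_mul_of_nonneg_right ?_ hr)
    nlinarith [pi_le_four]
  · rw [h.polarFilling_of_ge h1, h.polarFilling_of_ge h1]
    refine (h.lipschitz_curve.dist_le_mul _ _).trans ?_
    rw [Real.dist_eq, hc, mul_assoc]
    refine mul_le_mul_of_nonneg_left ?_ hK
    have hσl := h.lipschitz_param.dist_le_mul θ θ'
    rw [Real.dist_eq, Real.dist_eq] at hσl
    have hm1 : min r 1 ≤ 1 := min_le_right _ _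
    have hm2 : 1 / 2 ≤ min r 1 := le_min h1 (by norm_num)
    set m := min r 1
    rw [show (2 - 2 * m) * θ + (2 * m - 1) * σ θ - ((2 - 2 * m) * θ' + (2 * m - 1) * σ θ') =
      (2 - 2 * m) * (θ - θ') + (2 * m - 1) * (σ θ - σ θ') by ring]
    refine (abs_add_le _ _).trans ?_
    rw [abs_mul, abs_mul, abs_of_nonneg (by linarith : 0 ≤ 2 - 2 * m),
      abs_of_nonneg (by linarith : 0 ≤ 2 * m - 1)]
    have e1 : (2 - 2 * m) * |θ - θ'| ≤ 1 * |θ - θ'| :=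
      mul_le_mul_of_nonneg_right (by linarith) hΔ
    have e2 : (2 * m - 1) * |σ θ - σ θ'| ≤ 1 * (C * |θ - θ'|) :=
      mul_le_mul (by linarith) hσl (abs_nonneg _) (by norm_num)
    have e3 : (1 + C) * |θ - θ'| ≤ 2 * (1 + C) * (r * |θ - θ'|) := by
      have : 1 * |θ - θ'| ≤ 2 * r * |θ - θ'| := mul_le_mul_of_nonneg_right (by linarith) hΔ
      have := mul_le_mul_of_nonneg_left this (by positivity : (0 : ℝ) ≤ 1 + C)
      linarith
    have e4 : 0 ≤ (4 + 2 * (|σ 0| + (C + 1) * 4)) * (r * |θ - θ'|) := by positivity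
    linarith

/-- The filling is the restriction of a Lipschitz map on the whole plane. -/
theorem lipschitzWith_filling (h : HemisphereData K Ψ γ σ C) :
    LipschitzWith (lipConst K C σ * (2 + 1))
      fun x : Plane => polarFilling Ψ γ σ ‖x‖ (polarAngle x) :=
  lipschitzWith_polar h.polarFilling_periodic
    (fun _ _ _ hr hr' hθ => h.dist_radial_le hr hr' hθ)
    fun _ _ _ hr => h.dist_angular_le hr

end HemisphereData

/-! ### Decomposition of the disc into half annuli -/

/-- The closed upper and the open lower half plane. -/
def halfPlane (b : Bool) : Set Plane := if b then {x | 0 ≤ x 1} else {x | x 1 < 0}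

theorem measurableSet_halfPlane (b : Bool) : MeasurableSet (halfPlane b) := by
  have h1 : Measurable fun x : Plane => x 1 := Continuous.measurable (by fun_prop)
  cases b
  · exact measurableSet_lt h1 measurable_const
  · exact measurableSet_le measurable_const h1

theorem exists_polarAngle_mem (b : Bool) :
    ∃ c, |c| ≤ π ∧ ∀ x ∈ halfPlane b, polarAngle x ∈ Icc c (c + π) := by
  cases b
  · refine ⟨-π, by rw [abs_neg, abs_of_pos pi_pos], fun x hx => ⟨(abs_le.1 (abs_polarAngle_le x)).1, ?_⟩⟩
    have : polarAngle x < 0 := Complex.arg_neg_iff.2 hx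
    linarith
  · refine ⟨0, by simpa using pi_pos.le, fun x hx => ⟨Complex.arg_nonneg_iff.2 hx, ?_⟩⟩
    rw [zero_add]
    exact (abs_le.1 (abs_polarAngle_le x)).2

/-- A half annulus of the unit disc. -/
def cell (n : ℕ) (p : ℕ × Bool) : Set Plane :=
  (disc ∩ {x | (p.1 : ℝ) ≤ 2 * n * ‖x‖ ∧ 2 * n * ‖x‖ < p.1 + 1}) ∩ halfPlane p.2

theorem measurableSet_cell (n : ℕ) (p : ℕ × Bool) : MeasurableSet (cell n p) := by
  refine (Metric.isClosed_closedBall.measurableSet.inter ?_).inter (measurableSet_halfPlane _)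
  have h1 : Measurable fun x : Plane => 2 * n * ‖x‖ := measurable_norm.const_mul _
  exact (measurableSet_le measurable_const h1).inter (measurableSet_lt h1 measurable_const)

theorem cell_subset (n : ℕ) (p : ℕ × Bool) : cell n p ⊆ disc := fun _ hx => hx.1.1

theorem disc_subset_iUnion_cell (n : ℕ) : disc ⊆ ⋃ p, cell n p := by
  intro x hx
  have h0 : 0 ≤ 2 * n * ‖x‖ := by positivity
  by_cases hb : 0 ≤ x 1
  · exact mem_iUnion.2 ⟨(⌊2 * n * ‖x‖⌋₊, true), ⟨hx, Nat.floor_le h0, Nat.lt_floor_add_one _⟩, hb⟩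
  · exact mem_iUnion.2 ⟨(⌊2 * n * ‖x‖⌋₊, false), ⟨hx, Nat.floor_le h0, Nat.lt_floor_add_one _⟩,
      not_le.1 hb⟩

theorem pairwise_disjoint_cell (n : ℕ) : Pairwise (Function.onFun Disjoint (cell n)) := by
  rintro ⟨i, b⟩ ⟨j, b'⟩ hne
  refine Set.disjoint_left.2 fun x hx hy => hne ?_
  have h1 : i = j := by
    have e1 := hx.1.2.1.trans_lt hy.1.2.2
    have e2 := hy.1.2.1.trans_lt hx.1.2.2
    have e1' : i < j + 1 := by exact_mod_cast e1
    have e2' : j < i + 1 := by exact_mod_cast e2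
    omega
  have h2 : b = b' := by
    cases b <;> cases b'
    · rfl
    · exact absurd (show (0 : ℝ) ≤ x 1 from hy.2) (not_le.2 hx.2)
    · exact absurd (show (0 : ℝ) ≤ x 1 from hx.2) (not_le.2 hy.2)
    · rfl
  rw [h1, h2]

theorem cell_angle {n : ℕ} {p : ℕ × Bool} {x y : Plane} (hx : x ∈ cell n p) (hy : y ∈ cell n p) :
    |polarAngle x - polarAngle y| ≤ π := by
  obtain ⟨c, -, hc⟩ := exists_polarAngle_mem p.2
  have h1 := hc x hx.2
  have h2 := hc y hy.2
  rw [abs_le]; constructor <;> linarith [h1.1, h1.2, h2.1, h2.2]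

/-- A map to the plane given by Lipschitz functions of the polar coordinates is Lipschitz on a
half annulus. -/
theorem isLipschitz_cell {n : ℕ} (hn : 0 < n) {p : ℕ × Bool} (hp : 1 ≤ p.1)
    {u v : ℝ → ℝ → ℝ} {C : ℝ} (hC : 0 ≤ C)
    (hu : ∀ r r' θ θ', |θ| ≤ π → |θ'| ≤ π → r ∈ Icc (0 : ℝ) 1 → r' ∈ Icc (0 : ℝ) 1 →
      |u r θ - u r' θ'| ≤ C * (|r - r'| + |θ - θ'|))
    (hv : ∀ r r' θ θ', |θ| ≤ π → |θ'| ≤ π → r ∈ Icc (0 : ℝ) 1 → r' ∈ Icc (0 : ℝ) 1 →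
      |v r θ - v r' θ'| ≤ C * (|r - r'| + |θ - θ'|)) :
    IsLipschitz fun x : cell n p =>
      (!₂[u ‖x.1‖ (polarAngle x.1), v ‖x.1‖ (polarAngle x.1)] : Plane) := by
  have hn' : (0 : ℝ) < n := by exact_mod_cast hn
  refine ⟨Real.toNNReal (2 * (C * (1 + 4 * n))), LipschitzWith.of_dist_le_mul fun x y => ?_⟩
  rw [Real.coe_toNNReal _ (by positivity)]
  refine (dist_plane_le _ _).trans ?_
  have hr : ∀ x : cell n p, 1 / (2 * n) ≤ ‖x.1‖ := fun x => by
    rw [div_le_iff₀ (by positivity)]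
    have h1 := x.2.1.2.1
    have h2 : (1 : ℝ) ≤ p.1 := by exact_mod_cast hp
    linarith
  have hx1 : ∀ x : cell n p, ‖x.1‖ ∈ Icc (0 : ℝ) 1 := fun x =>
    ⟨norm_nonneg _, by simpa using x.2.1.1⟩
  have h3 := abs_polarAngle_sub_le (by positivity) (hr x) (hr y) (cell_angle x.2 y.2)
  have h4 : |‖x.1‖ - ‖y.1‖| ≤ dist x y := abs_norm_sub_le_dist _ _
  have h5 : |polarAngle x.1 - polarAngle y.1| ≤ 4 * n * dist x y := by
    rw [div_mul_eq_mul_div, one_mul, div_le_iff₀ (by positivity)] at h3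
    have h6 : π / 2 * dist x.1 y.1 ≤ 2 * dist x y := by
      change π / 2 * dist x y ≤ _
      have := pi_le_four
      have := dist_nonneg (x := x) (y := y)
      nlinarith
    nlinarith
  have h7 : |‖x.1‖ - ‖y.1‖| + |polarAngle x.1 - polarAngle y.1| ≤ (1 + 4 * n) * dist x y := by
    linarith
  have h8 := mul_le_mul_of_nonneg_left h7 hC
  have h9 := hu _ _ _ _ (abs_polarAngle_le x.1) (abs_polarAngle_le y.1) (hx1 x) (hx1 y)
  have h10 := hv _ _ _ _ (abs_polarAngle_le x.1) (abs_polarAngle_le y.1) (hx1 x) (hx1 y)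
  simp
  linarith

namespace HemisphereData

variable {K C : ℝ≥0} {Ψ : ℝ → ℝ → X} {γ : ℝ → X} {σ : ℝ → ℝ}

/-- In the collar the map only runs along `γ`, so it factors through a line in the plane, which is a
null set. -/
theorem area_cell_annulus (h : HemisphereData K Ψ γ σ C) (A : AreaFunctional.{u}) {n : ℕ}
    (hn : 0 < n) {p : ℕ × Bool} (hp : n ≤ p.1) :
    A.area (fun x : cell n p => polarFilling Ψ γ σ ‖x.1‖ (polarAngle x.1)) = 0 := by
  have hn' : (0 : ℝ) < n := by exact_mod_cast hn
  have hT := isLipschitz_cell hn (p := p) (hn.trans_le hp)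
    (u := fun r θ => (2 - 2 * r) * θ + (2 * r - 1) * σ θ) (v := fun _ _ => 0)
    (C := 2 * (|σ 0| + (C + 1) * 4) + (2 + C)) (by positivity) ?_ ?_
  · refine A.area_eq_zero_of_factor (measurableSet_cell n p) hT (g := fun q => γ (q 0)) (K := K)
      (R := {x : Plane | x 1 = 0}) ?_ ?_ ?_ ?_
    · refine LipschitzWith.of_dist_le_mul fun x y => (h.lipschitz_curve.dist_le_mul _ _).trans ?_
      refine mul_le_mul_of_nonneg_left ?_ K.coe_nonneg
      rw [dist_plane_eq, Real.dist_eq]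
      exact abs_le_sqrt (by nlinarith [sq_nonneg (x 1 - y 1)])
    · intro x
      have h1 : 1 / 2 ≤ ‖x.1‖ := by
        have h2 := x.2.1.2.1
        have h3 : (n : ℝ) ≤ p.1 := by exact_mod_cast hp
        rw [div_le_iff₀ two_pos]
        by_contra! h4
        nlinarith
      have h2 : ‖x.1‖ ≤ 1 := by simpa using x.2.1.1
      rw [h.polarFilling_of_ge h1, min_eq_left h2]
      rfl
    · intro x; simp
    · have : {x : Plane | x 1 = 0} = ⋃ k : ℕ, rectangle (-k) k 0 0 := by
        ext x
        simp only [mem_ofPred_eq, mem_iUnion, rectangle, mem_Icc]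
        constructor
        · intro hx
          obtain ⟨k, hk⟩ := exists_nat_ge |x 0|
          exact ⟨k, abs_le.1 hk, hx.ge, hx.le⟩
        · rintro ⟨k, -, h1, h2⟩
          exact le_antisymm h2 h1
      rw [this, measure_iUnion_null_iff]
      intro k
      rw [volume_rectangle]; simp
  · intro r r' θ θ' hθ hθ' hr hr'
    have hC := C.coe_nonneg
    have e0 := h.abs_param_sub_le hθ
    have hσl := h.lipschitz_param.dist_le_mul θ θ'
    rw [Real.dist_eq, Real.dist_eq] at hσl
    have hΔ := abs_nonneg (θ - θ')
    have hρ := abs_nonneg (r - r')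
    rw [show (2 - 2 * r) * θ + (2 * r - 1) * σ θ - ((2 - 2 * r') * θ' + (2 * r' - 1) * σ θ') =
      2 * (r - r') * (σ θ - θ) + ((2 - 2 * r') * (θ - θ') + (2 * r' - 1) * (σ θ - σ θ')) by ring]
    refine (abs_add_le _ _).trans ?_
    have e1 : |2 * (r - r') * (σ θ - θ)| ≤ 2 * |r - r'| * (|σ 0| + (C + 1) * 4) := by
      rw [abs_mul, abs_mul, abs_of_pos (two_pos : (0 : ℝ) < 2)]
      exact mul_le_mul_of_nonneg_left e0 (by positivity)
    have e2 : |(2 - 2 * r') * (θ - θ') + (2 * r' - 1) * (σ θ - σ θ')| ≤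
        2 * |θ - θ'| + 1 * (C * |θ - θ'|) := by
      refine (abs_add_le _ _).trans (add_le_add ?_ ?_)
      · rw [abs_mul, abs_of_nonneg (by linarith [hr'.2])]
        exact mul_le_mul_of_nonneg_right (by linarith [hr'.1]) hΔ
      · rw [abs_mul]
        exact mul_le_mul (abs_le.2 ⟨by linarith [hr'.1], by linarith [hr'.2]⟩) hσl (abs_nonneg _)
          zero_le_one
    have e3 : 0 ≤ (|σ 0| + (C + 1) * 4) * |θ - θ'| := by positivity
    have e4 : 0 ≤ (2 + C) * |r - r'| := by positivity
    nlinarith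
  · intro r r' θ θ' _ _ _ _
    simp only [sub_self, abs_zero]
    positivity

/-- Polar coordinates are not Lipschitz near the origin. There the global Lipschitz constant is used
on a disc of radius 1/(2n), at a cost that vanishes as n grows. -/
theorem area_cell_center (h : HemisphereData K Ψ γ σ C) (A : AreaFunctional.{u}) {n : ℕ}
    (hn : 0 < n) (b : Bool) :
    A.area (fun x : cell n (0, b) => polarFilling Ψ γ σ ‖x.1‖ (polarAngle x.1)) ≤
      ENNReal.ofReal ((lipConst K C σ * (2 + 1)) ^ 2 * (π / (2 * n) ^ 2)) := by
  have hn' : (0 : ℝ) < n := by exact_mod_cast hn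
  refine (A.area_le_of_factor (measurableSet_cell n (0, b)) (T := fun x => x.1)
    ⟨1, LipschitzWith.subtype_val _⟩ Subtype.val_injective h.lipschitzWith_filling
    (fun x => rfl) (R := Metric.closedBall 0 (1 / (2 * n))) fun x => ?_).trans (le_of_eq ?_)
  · rw [mem_closedBall_zero_iff, le_div_iff₀ (by positivity)]
    have := x.2.1.2.2
    simp only [Nat.cast_zero, zero_add] at this
    linarith
  · rw [EuclideanSpace.volume_closedBall_fin_two, ENNReal.ofReal_mul (by positivity),
      div_eq_mul_inv π, mul_comm π, ENNReal.ofReal_mul (by positivity), ← ENNReal.ofReal_pow (by positivity)]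
    congr 1
    · rw [ENNReal.ofReal_pow (by positivity)]
      congr 1
      rw [← ENNReal.ofReal_coe_nnreal]; push_cast; rfl
    · congr 1
      rw [one_div, inv_pow]

/-- The cell is mapped into a flat rectangle of sides π/(2n) and π sin R, where R is the larger
spherical radius; this widens the band slightly but makes the remaining map K-Lipschitz. -/
theorem area_cell_hemisphere (h : HemisphereData K Ψ γ σ C) (A : AreaFunctional.{u}) {n : ℕ}
    {p : ℕ × Bool} (hp : 1 ≤ p.1) (hpn : p.1 < n) :
    A.area (fun x : cell n p => polarFilling Ψ γ σ ‖x.1‖ (polarAngle x.1)) ≤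
      ENNReal.ofReal ((K : ℝ) ^ 2 * (π / (2 * n) * sin ((p.1 + 1) * (π / (2 * n))) * π)) := by
  have hn : 0 < n := by omega
  have hn' : (0 : ℝ) < n := by exact_mod_cast hn
  set R := (p.1 + 1) * (π / (2 * n)) with hR
  have hR0 : 0 < R := by positivity
  have hR1 : R ≤ π / 2 := by
    have : (p.1 : ℝ) + 1 ≤ n := by exact_mod_cast hpn
    calc R ≤ n * (π / (2 * n)) := mul_le_mul_of_nonneg_right this (by positivity)
      _ = π / 2 := by field_simp
  have hs : 0 < sin R := sin_pos_of_pos_of_lt_pi hR0 (by linarith [pi_pos])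
  have hnorm : ∀ x : cell n p, p.1 * (π / (2 * n)) ≤ π * ‖x.1‖ ∧ π * ‖x.1‖ ≤ R := by
    intro x
    have e : π * ‖x.1‖ = (2 * n * ‖x.1‖) * (π / (2 * n)) := by field_simp
    rw [e]
    have h0 : 0 ≤ π / (2 * n) := by positivity
    exact ⟨mul_le_mul_of_nonneg_right x.2.1.2.1 h0, mul_le_mul_of_nonneg_right x.2.1.2.2.le h0⟩
  obtain ⟨c, -, hc⟩ := exists_polarAngle_mem p.2
  have hT := isLipschitz_cell hn (p := p) hp
    (u := fun r _ => π * r) (v := fun _ θ => sin R * θ) (C := π) pi_pos.le ?_ ?_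
  · refine (A.area_le_of_factor (measurableSet_cell n p) hT (K := K)
      -- Clamping the radius to [0, R] extends the estimate on the cap to a K-Lipschitz map on the
      -- whole plane.
      (g := fun q => Ψ (max 0 (min (q 0) R)) (q 1 / sin R)) ?_ ?_ ?_
      (R := rectangle (p.1 * (π / (2 * n))) R (sin R * c) (sin R * (c + π))) ?_).trans (le_of_eq ?_)
    · intro x y hxy
      have e0 := congrArg (fun q : Plane => q 0) hxy
      have e1 := congrArg (fun q : Plane => q 1) hxy
      simp only [Matrix.cons_val_zero, Matrix.cons_val_one] at e0 e1
      exact Subtype.ext (plane_ext (mul_left_cancel₀ pi_ne_zero e0) (mul_left_cancel₀ hs.ne' e1))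
    · refine LipschitzWith.of_dist_le_mul fun x y => ?_
      have hm : ∀ t : ℝ, max 0 (min t R) ∈ Icc 0 R := fun t =>
        ⟨le_max_left _ _, max_le hR0.le (min_le_right _ _)⟩
      refine (h.dist_le hR1 (hm _) (hm _) _ _).trans ?_
      refine mul_le_mul_of_nonneg_left ?_ K.coe_nonneg
      rw [dist_plane_eq]
      apply sqrt_le_sqrt
      have e1 : sin R * (x 1 / sin R - y 1 / sin R) = x 1 - y 1 := by field_simp
      rw [e1]
      refine add_le_add_left ?_ _
      refine sq_le_sq.2 ?_
      refine (abs_max_sub_max_le_max _ _ _ _).trans ?_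
      rw [sub_self, abs_zero, max_eq_right (abs_nonneg _)]
      simpa using abs_min_sub_min_le_max (x 0) R (y 0) R
    · intro x
      have h1 := hnorm x
      have h2 : ‖x.1‖ ≤ 1 / 2 := by
        have := h1.2.trans hR1
        by_contra! h3
        nlinarith [pi_pos]
      simp only [Matrix.cons_val_zero, Matrix.cons_val_one]
      rw [polarFilling, if_pos h2, min_eq_left h1.2, max_eq_right (by positivity),
        mul_div_cancel_left₀ _ hs.ne']
    · intro x
      have h1 := hnorm x
      have h2 := hc x.1 x.2.2
      simp only [rectangle, mem_ofPred_eq, Matrix.cons_val_zero,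
        Matrix.cons_val_one]
      exact ⟨h1, mul_le_mul_of_nonneg_left h2.1 hs.le, mul_le_mul_of_nonneg_left h2.2 hs.le⟩
    · rw [volume_rectangle, ENNReal.ofReal_mul (by positivity),
        ENNReal.ofReal_pow K.coe_nonneg, ENNReal.ofReal_coe_nnreal,
        ← ENNReal.ofReal_mul (by rw [hR, add_mul, one_mul]; ring_nf; positivity)]
      congr 2
      rw [hR]; ring
  · intro r r' θ θ' _ _ _ _
    rw [← mul_sub, abs_mul, abs_of_pos pi_pos]
    exact mul_le_mul_of_nonneg_left (le_add_of_nonneg_right (abs_nonneg _)) pi_pos.le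
  · intro r r' θ θ' _ _ _ _
    rw [← mul_sub, abs_mul, abs_of_pos hs]
    refine mul_le_mul ?_ (le_add_of_nonneg_left (abs_nonneg _)) (abs_nonneg _) pi_pos.le
    linarith [sin_le_one R, pi_gt_three]

end HemisphereData

/-- A right-endpoint Riemann sum for the integral of sin over [0, π/2], which is 1. Each term is
compared with a difference of cosines; the differences telescope, and δ² absorbs the error. -/
theorem sum_sin_le {n : ℕ} (hn : 2 ≤ n) :
    ∑ i ∈ Finset.range n, π / (2 * n) * sin ((i + 1) * (π / (2 * n))) ≤ 1 + π ^ 2 / (4 * n) := by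
  have hn' : (2 : ℝ) ≤ n := by exact_mod_cast hn
  set δ := π / (2 * n) with hδ
  have hδ0 : 0 < δ := by positivity
  have hδ1 : δ ≤ 1 := by
    rw [hδ, div_le_one (by positivity)]; linarith [pi_le_four]
  have h1 : ∀ i ∈ Finset.range n, δ * sin ((i + 1) * δ) ≤
      (cos (i * δ) - cos ((i + 1 : ℕ) * δ)) + δ ^ 2 := by
    intro i _
    push_cast
    set b := ((i : ℝ) + 1) * δ
    have e : (i : ℝ) * δ = b - δ := by ring
    rw [e, cos_sub]
    have h2 := sin_gt_sub_cube hδ0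
    have h3 := one_sub_sq_div_two_le_cos (x := δ)
    have h4 := cos_le_one δ
    have h5 := cos_le_one b
    have h6 := sin_le_one b
    have h7 := neg_one_le_sin b
    have h8 : sin δ ≤ δ := sin_le hδ0.le
    have h9 : δ ^ 3 ≤ δ ^ 2 := by nlinarith [sq_nonneg δ]
    nlinarith
  refine (Finset.sum_le_sum h1).trans ?_
  rw [Finset.sum_add_distrib, Finset.sum_range_sub' (fun i : ℕ => cos (i * δ)), Finset.sum_const,
    Finset.card_range, nsmul_eq_mul]
  have e1 : (n : ℝ) * δ = π / 2 := by rw [hδ]; field_simp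
  have e2 : (n : ℝ) * δ ^ 2 = π ^ 2 / (4 * n) := by rw [hδ]; field_simp; norm_num
  rw [e1, e2]
  simp

namespace HemisphereData

variable {K C : ℝ≥0} {Ψ : ℝ → ℝ → X} {γ : ℝ → X} {σ : ℝ → ℝ}

theorem area_le_of_two_le (h : HemisphereData K Ψ γ σ C) (A : AreaFunctional.{u}) {n : ℕ}
    (hn : 2 ≤ n) :
    A.area (fun x : disc => polarFilling Ψ γ σ ‖x.1‖ (polarAngle x.1)) ≤
      ENNReal.ofReal (2 * ((lipConst K C σ * (2 + 1)) ^ 2 * (π / (2 * n) ^ 2) +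
        K ^ 2 * ((1 + π ^ 2 / (4 * n)) * π))) := by
  have hn0 : 0 < n := by omega
  have hn' : (0 : ℝ) < n := by exact_mod_cast hn0
  -- The sine term is kept also for i = 0, where it is not needed, so that the sum is the full
  -- Riemann sum.
  let ω : ℕ → ℝ := fun i => (if i = 0 then (lipConst K C σ * (2 + 1)) ^ 2 * (π / (2 * n) ^ 2) else 0) +
    K ^ 2 * (π / (2 * n) * sin ((i + 1) * (π / (2 * n))) * π)
  have hsin : ∀ i < n, 0 ≤ sin (((i : ℝ) + 1) * (π / (2 * n))) := by
    intro i hi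
    refine sin_nonneg_of_nonneg_of_le_pi (by positivity) ?_
    have : (i : ℝ) + 1 ≤ n := by exact_mod_cast hi
    calc ((i : ℝ) + 1) * (π / (2 * n)) ≤ n * (π / (2 * n)) :=
          mul_le_mul_of_nonneg_right this (by positivity)
      _ = π / 2 := by field_simp
      _ ≤ π := by linarith [pi_pos]
  have hω : ∀ i < n, 0 ≤ ω i := by
    intro i hi
    have := hsin i hi
    simp only [ω]
    split_ifs <;> positivity
  have hcell : ∀ p : ℕ × Bool,
      A.area (fun x : cell n p => polarFilling Ψ γ σ ‖x.1‖ (polarAngle x.1)) ≤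
        if p.1 < n then ENNReal.ofReal (ω p.1) else 0 := by
    rintro ⟨i, b⟩
    split_ifs with hi
    · rcases Nat.eq_zero_or_pos i with rfl | hi0
      · refine (h.area_cell_center A hn0 b).trans (ENNReal.ofReal_le_ofReal ?_)
        have := hsin 0 hn0
        simp only [ω, if_true]
        exact le_add_of_nonneg_right (by positivity)
      · refine (h.area_cell_hemisphere A (p := (i, b)) hi0 hi).trans
          (ENNReal.ofReal_le_ofReal (le_of_eq ?_))
        simp only [ω, if_neg hi0.ne', zero_add]
    · exact (h.area_cell_annulus A hn0 (p := (i, b)) (not_lt.1 hi)).le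
  have hL : IsLipschitz fun x : disc => polarFilling Ψ γ σ ‖x.1‖ (polarAngle x.1) :=
    ⟨_, h.lipschitzWith_filling.comp (LipschitzWith.subtype_val _)⟩
  rw [A.area_eq_tsum _ (cell n) (cell_subset n) Metric.isClosed_closedBall.measurableSet
    (measurableSet_cell n) (disc_subset_iUnion_cell n) (pairwise_disjoint_cell n) hL]
  refine (ENNReal.tsum_le_tsum hcell).trans ?_
  rw [ENNReal.tsum_prod (f := fun i (_ : Bool) => if i < n then ENNReal.ofReal (ω i) else 0)]
  simp only [tsum_bool]
  rw [tsum_eq_sum (s := Finset.range n) (fun i hi => by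
    simp [Finset.mem_range.not.1 hi])]
  have h1 : ∀ i ∈ Finset.range n, (if i < n then ENNReal.ofReal (ω i) else 0) +
      (if i < n then ENNReal.ofReal (ω i) else 0) = ENNReal.ofReal (2 * ω i) := by
    intro i hi
    rw [if_pos (Finset.mem_range.1 hi), ← ENNReal.ofReal_add (hω i (Finset.mem_range.1 hi))
      (hω i (Finset.mem_range.1 hi)), two_mul]
  rw [Finset.sum_congr rfl h1, ← ENNReal.ofReal_sum_of_nonneg (fun i hi =>
    mul_nonneg two_pos.le (hω i (Finset.mem_range.1 hi))), ← Finset.mul_sum]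
  refine ENNReal.ofReal_le_ofReal (mul_le_mul_of_nonneg_left ?_ two_pos.le)
  simp only [ω]
  rw [Finset.sum_add_distrib, Finset.sum_ite_eq' , if_pos (Finset.mem_range.2 hn0),
    ← Finset.mul_sum, ← Finset.sum_mul]
  have := sum_sin_le hn
  gcongr

/-- The bound is K² times the area 2π of the unit hemisphere: the two half planes contribute π each
in the limit n → ∞. -/
theorem area_le (h : HemisphereData K Ψ γ σ C) (A : AreaFunctional.{u}) :
    A.area (fun x : disc => polarFilling Ψ γ σ ‖x.1‖ (polarAngle x.1)) ≤
      ENNReal.ofReal (2 * π * K ^ 2) := by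
  have hlim : Tendsto (fun n : ℕ => 2 * ((lipConst K C σ * (2 + 1)) ^ 2 * (π / (2 * n) ^ 2) +
      K ^ 2 * ((1 + π ^ 2 / (4 * n)) * π)) : ℕ → ℝ) atTop
      (𝓝 (2 * ((lipConst K C σ * (2 + 1)) ^ 2 * 0 + K ^ 2 * ((1 + 0) * π)))) := by
    have hn : Tendsto (fun n : ℕ => (n : ℝ)) atTop atTop := tendsto_natCast_atTop_atTop
    have h1 : Tendsto (fun n : ℕ => π / (2 * (n : ℝ)) ^ 2) atTop (𝓝 0) :=
      tendsto_const_nhds.div_atTop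
        ((tendsto_pow_atTop two_ne_zero).comp (hn.const_mul_atTop two_pos))
    have h2 : Tendsto (fun n : ℕ => π ^ 2 / (4 * (n : ℝ))) atTop (𝓝 0) :=
      tendsto_const_nhds.div_atTop (hn.const_mul_atTop four_pos)
    exact ((h1.const_mul _).add (((h2.const_add 1).mul_const π).const_mul _)).const_mul 2
  have hlim' := (ENNReal.continuous_ofReal.tendsto _).comp hlim
  rw [show (2 * π * K ^ 2 : ℝ) = 2 * ((lipConst K C σ * (2 + 1)) ^ 2 * 0 + K ^ 2 * ((1 + 0) * π)) by
    ring]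
  refine ge_of_tendsto hlim' ?_
  filter_upwards [eventually_ge_atTop 2] with n hn using h.area_le_of_two_le A hn

end HemisphereData

end Filling

end

end QuadIsop

theorem theorem1p2 {X : Type*} [MetricSpace X] [MeasurableSpace X] [BorelSpace X]
    (A : QuadIsop.AreaFunctional)
    (hX : ∃ b : QuadIsop.WassersteinOne X → X, QuadIsop.IsContractingBarycenterMap b) :
    QuadIsop.QuadraticIsoperimetricInequality X A (1 / (2 * Real.pi)) := by
  obtain ⟨b, hb⟩ := hX
  rintro η ⟨C, hη⟩
  have hc : LipschitzWith (C * 2) fun t => η (QuadIsop.circleParam t) :=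
    hη.comp QuadIsop.lipschitzWith_circleParam
  obtain ⟨γ, σ, C', hγ, hγp, hσ, hσT, hγσ⟩ := QuadIsop.exists_constantSpeed hc Real.two_pi_pos
    fun t => congrArg η (QuadIsop.circleParam_periodic t)
  have hfin : QuadIsop.curveLength η ≠ ∞ :=
    ((QuadIsop.eVariationOn_Icc_le hc Real.two_pi_pos.le).trans_lt
      (ENNReal.mul_lt_top ENNReal.coe_lt_top ENNReal.ofReal_lt_top)).ne
  change LipschitzWith (Real.toNNReal ((QuadIsop.curveLength η).toReal / (2 * Real.pi))) γ at hγ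
  have hdata : QuadIsop.HemisphereData _ (QuadIsop.hemisphereMap b hγ) γ σ C' :=
    ⟨fun hR hr hr' θ θ' => QuadIsop.dist_hemisphereMap_le hb hγ hγp hR hr hr' θ θ',
      fun θ => if_neg (lt_irrefl _), QuadIsop.hemisphereMap_periodic hγ hγp, hγ, hγp, hσ, hσT⟩
  have hfill : QuadIsop.IsFilling η fun x : QuadIsop.disc =>
      QuadIsop.polarFilling (QuadIsop.hemisphereMap b hγ) γ σ ‖x.1‖ (QuadIsop.polarAngle x.1) := by
    refine ⟨⟨_, hdata.lipschitzWith_filling.comp (LipschitzWith.subtype_val _)⟩, fun p => ?_⟩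
    have hp : ‖(p : QuadIsop.Plane)‖ = 1 := by simp
    change QuadIsop.polarFilling _ γ σ ‖p.1‖ (QuadIsop.polarAngle p.1) = _
    -- At radius 1 the homotopy has reached `γ ∘ σ`, which is the given curve.
    rw [hdata.polarFilling_of_ge (by rw [hp]; norm_num), hp, min_self]
    conv_rhs => rw [← QuadIsop.circleParam_polarAngle p, ← hγσ]
    congr 1; ring
  refine (iInf₂_le _ hfill).trans ((hdata.area_le A).trans (le_of_eq ?_))
  have hV : 0 ≤ (QuadIsop.curveLength η).toReal := ENNReal.toReal_nonneg
  rw [Real.coe_toNNReal _ (by positivity)]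
  conv_rhs => rw [← ENNReal.ofReal_toReal hfin]
  rw [← ENNReal.ofReal_pow hV, ← ENNReal.ofReal_mul (by positivity)]
  -- With K = L/2π the bound 2πK² becomes L²/2π.
  congr 1
  field_simp
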